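/- Let $f:\mathbb R\to(0,\infty)$ be a continuously differentiable, everywhere positive probability density, and for $\theta\in\mathbb R$ let $F_\theta$ be the distribution on $\mathbb R$ with density $f(\cdot-\theta)$. Let $\psi:[0,1]\to\mathbb R$ be differentiable with bounded derivative $\psi'$ and $\int_0^1\psi(u)\,du>0$ (then $\int_0^1\psi(u)\,du<\infty$ and $\int_0^1\psi(u)^2\,du<\infty$ automatically). For a sample $Y_1,\dots,Y_I$ put $$T_I=\frac{\sum_{i=1}^I \mathrm{sgn}(Y_i)\,q_i}{\sum_{i=1}^I q_i},\qquad \mathrm{sgn}(y)=\mathbf 1(y\ge 0),\qquad q_i=\psi\!\left(\frac{\mathrm{rank}(|Y_i|)}{I+1}\right),$$ where $\mathrm{rank}(|Y_i|)=\#\{j\le I:|Y_j|\le|Y_i|\}$ and $q_i=0$ if $Y_i=0$. Then: 1. There are functions $\mu:\mathbb R\to\mathbb R$ and $\sigma:\mathbb R\to(0,\infty)$ such that for every fixed $\theta$, if $Y_1,\dots,Y_I$ are independent with distribution $F_\theta$, $$\frac{\sqrt I\,(T_I-\mu(\theta))}{\sigma(\theta)}\xrightarrow{d}\mathcal N(0,1)\qquad(I\to\infty).\tag{$*$}$$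 2. For all functions $\mu$ and $\sigma>0$ such that $(*)$ holds at every fixed $\theta$, and for every $\theta_0\in\mathbb R$ and $h>0$: with $\theta_I=\theta_0+h/\sqrt I$, if for each $I$ the variables $Y_1,\dots,Y_I$ are independent with distribution $F_{\theta_I}$, then $$\frac{\sqrt I\,(T_I-\mu(\theta_I))}{\sigma(\theta_I)}\xrightarrow{d}\mathcal N(0,1)\qquad(I\to\infty).$$ -/

import Mathlib

open MeasureTheory ProbabilityTheory Filter Set

noncomputable section

/-- A positive, continuously differentiable probability density on the real line. -/
structure PositiveC1Density where
  f : ℝ → ℝ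
  pos : ∀ x, 0 < f x
  contDiff : ContDiff ℝ 1 f
  lintegral_eq_one : ∫⁻ x, ENNReal.ofReal (f x) = 1

/-- The member `F_θ` of the location family generated by `d`: the law on the real line with
density `x ↦ f (x - θ)`. -/
def locationLaw (d : PositiveC1Density) (θ : ℝ) : Measure ℝ :=
  volume.withDensity fun x => ENNReal.ofReal (d.f (x - θ))

instance instIsProbabilityMeasureLocationLaw (d : PositiveC1Density) (θ : ℝ) :
    IsProbabilityMeasure (locationLaw d θ) := by
  constructor
  rw [locationLaw, withDensity_apply _ MeasurableSet.univ, Measure.restrict_univ,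
    lintegral_sub_right_eq_self (fun x => ENNReal.ofReal (d.f x)) θ, d.lintegral_eq_one]

/-- The joint law of `I` independent pair differences `Y_1, …, Y_I`, each with law `F_θ`. -/
abbrev sampleLaw (d : PositiveC1Density) (θ : ℝ) (I : ℕ) : Measure (Fin I → ℝ) :=
  Measure.pi fun _ => locationLaw d θ

/-- The rank of `|y_i|` among `|y_1|, …, |y_I|`: the number of `j` with `|y_j| ≤ |y_i|`. -/
def absRank {I : ℕ} (y : Fin I → ℝ) (i : Fin I) : ℕ :=
  {j : Fin I | |y j| ≤ |y i|}.ncard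

/-- The sign used by the statistic: `1` if `t ≥ 0` and `0` otherwise. -/
def sgnInd (t : ℝ) : ℝ := if 0 ≤ t then 1 else 0

/-- The score `q_i = ψ(rank(|y_i|) / (I + 1))`, with the convention `q_i = 0` if `y_i = 0`. -/
def rankScore (ψ : ℝ → ℝ) {I : ℕ} (y : Fin I → ℝ) (i : Fin I) : ℝ :=
  if y i = 0 then 0 else ψ ((absRank y i : ℝ) / ((I : ℝ) + 1))

/-- The normalized signed score statistic `T = (∑ sgn(y_i) q_i) / (∑ q_i)`. -/
def signedScore (ψ : ℝ → ℝ) {I : ℕ} (y : Fin I → ℝ) : ℝ :=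
  (∑ i, sgnInd (y i) * rankScore ψ y i) / ∑ i, rankScore ψ y i

/-- `μ(θ)` and `σ(θ) > 0` are the asymptotic centre and scale of the statistic at every
fixed `θ`: under `F_θ`, `√I (T - μ(θ)) / σ(θ)` converges in distribution to `N(0,1)`. -/
def IsAsymptoticCentreScale (d : PositiveC1Density) (ψ μ σ : ℝ → ℝ) : Prop :=
  ∀ θ : ℝ, 0 < σ θ ∧
    TendstoInDistribution
      (fun (I : ℕ) (y : Fin I → ℝ) => √(I : ℝ) * (signedScore ψ y - μ θ) / σ θ)
      atTop (id : ℝ → ℝ) (fun I => sampleLaw d θ I) (gaussianReal 0 1)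

end

/-!
The statistic `T` is shown to be asymptotically normal along *every* bounded sequence of parameters
`θ_I`, with an explicit centre and scale. Fixed parameters give the existence claim. For the second
claim, `μ` and `σ` are determined pointwise by the fixed-parameter limit (`centre_scale_unique`,
a comparison of characteristic functions), hence equal the explicit ones, and the local sequence
`θ₀ + h / √I` is bounded. No contiguity argument is needed.

Let `G(y) = P(|Y| ≤ |y|)` under the law `P` at hand. Then `G(Y)` is uniform on `[0, 1]`, ordering
the `|Y_i|` is the same as ordering the `G(Y_i)`, and so all rank phenomena can be transported to
a uniform sample, where they do not involve the parameter. With the weight `w = sgn - μ`, where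
`μ = E[sgn(Y) ψ(G(Y))] / ∫ ψ`, the centred statistic is the ratio
`T - μ = ∑ w(Y_i) ψ(R_i) / ∑ ψ(R_i)`, where `R_i` is the normalized rank. The argument has these
ingredients.

* Linearization. Replacing `ψ(R_i)` by its first-order expansion at `G(Y_i)` costs an error whose
  average over `i`, multiplied by `√I`, tends to zero in `L¹` (`SmoothScore.tendsto_taylorErr`): given
  `G(Y_i) = x`, the difference `R_i - x` has second moment `O(1 / I)`, so differentiability of `ψ`
  at `x` and dominated convergence suffice, and no regularity of `ψ'` is used. The linear
  term is a double sum in the kernel `w(z) ψ'(G z) (1(G z' ≤ G z) - G z)`; after its projection on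
  the second variable is subtracted, the kernel is degenerate in both variables and the double sum
  has second moment `O(I ^ 2)` (`integral_sq_sum_sum_le`). What remains is a sum of independent
  copies of the bounded influence function.
* The central limit theorem for rows of independent, uniformly bounded variables
  (`tendsto_integral_cexp_sum`), together with a Slutsky argument for the denominator
  (`tendsto_integral_cexp_ratio`).
* A lower bound on the variance of the influence function `L`, uniform over bounded parameter sets
  (`exists_le_rankVariance`). All rank terms are even in `z`, so `L z - L (-z) = ψ (G z)` for
  `z > 0`; since `f` is bounded above and below on compact sets, the masses near `z` and `-z` are
  comparable, which bounds `∫ ψ ^ 2` over a large compact set by a multiple of the variance.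
-/

open scoped Topology Function

/-! ### Characteristic functions, Slutsky's theorem and a central limit theorem for rows -/

theorem norm_cexp_mul_I_sub_le (a b : ℝ) :
    ‖Complex.exp (a * Complex.I) - Complex.exp (b * Complex.I)‖ ≤ |a - b| := by
  have h : Complex.exp (a * Complex.I) - Complex.exp (b * Complex.I)
      = Complex.exp (b * Complex.I) * (Complex.exp (Complex.I * ((a - b : ℝ) : ℂ)) - 1) := by
    rw [mul_sub, ← Complex.exp_add, mul_one]
    congr 2
    push_cast
    ring
  rw [h, norm_mul, Complex.norm_exp_ofReal_mul_I, one_mul]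
  simpa using Real.norm_exp_I_mul_ofReal_sub_one_le (x := a - b)

theorem norm_cexp_mul_I_sub_le_two (a b : ℝ) :
    ‖Complex.exp (a * Complex.I) - Complex.exp (b * Complex.I)‖ ≤ 2 := by
  refine (norm_sub_le _ _).trans ?_
  rw [Complex.norm_exp_ofReal_mul_I, Complex.norm_exp_ofReal_mul_I]
  norm_num

theorem tendstoInDistribution_stdGaussian_iff {Ω : ℕ → Type*} {m : ∀ n, MeasurableSpace (Ω n)}
    {μ : ∀ n, Measure (Ω n)} [∀ n, IsProbabilityMeasure (μ n)] {X : ∀ n, Ω n → ℝ}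
    (hX : ∀ n, AEMeasurable (X n) (μ n)) :
    TendstoInDistribution X atTop (id : ℝ → ℝ) μ (gaussianReal 0 1) ↔
      ∀ t : ℝ, Tendsto (fun n => ∫ ω, Complex.exp ((t * X n ω : ℝ) * Complex.I) ∂μ n) atTop
        (𝓝 (Complex.exp (-(t ^ 2 / 2 : ℝ)))) := by
  have key : ∀ n t, charFun ((μ n).map (X n)) t
      = ∫ ω, Complex.exp ((t * X n ω : ℝ) * Complex.I) ∂μ n := by
    intro n t
    rw [charFun_apply_real, integral_map (hX n) (by fun_prop)]
    simp
  have key2 : ∀ t, charFun ((gaussianReal 0 1).map (id : ℝ → ℝ)) t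
      = Complex.exp (-(t ^ 2 / 2 : ℝ)) := by
    intro t
    rw [Measure.map_id, charFun_gaussianReal]
    congr 1
    push_cast
    simp
  constructor
  · intro h t
    have := ProbabilityMeasure.tendsto_iff_tendsto_charFun.1 h.tendsto t
    simp only [ProbabilityMeasure.coe_mk, key, key2] at this
    exact this
  · intro h
    refine ⟨hX, aemeasurable_id, ProbabilityMeasure.tendsto_iff_tendsto_charFun.2 fun t => ?_⟩
    simp only [ProbabilityMeasure.coe_mk, key, key2]
    exact h t

theorem integrable_of_abs_le {Ω : Type*} {m : MeasurableSpace Ω} {μ : Measure Ω}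
    [IsFiniteMeasure μ] {f : Ω → ℝ} (hf : AEMeasurable f μ) {M : ℝ} (hM : ∀ ω, |f ω| ≤ M) :
    Integrable f μ :=
  Integrable.of_bound hf.aestronglyMeasurable M (ae_of_all _ hM)

theorem integrable_cexp_mul_I {Ω : Type*} {m : MeasurableSpace Ω} {μ : Measure Ω}
    [IsFiniteMeasure μ] {f : Ω → ℝ} (hf : AEMeasurable f μ) :
    Integrable (fun ω => Complex.exp ((f ω : ℝ) * Complex.I)) μ := by
  refine Integrable.of_bound (C := 1) ?_ (ae_of_all _ fun ω => ?_)
  · refine AEMeasurable.aestronglyMeasurable ?_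
    fun_prop
  · rw [Complex.norm_exp_ofReal_mul_I]

/-- The pointwise estimate behind Slutsky's theorem for a ratio. The last term dominates the trivial
bound `2` where `D` is not within `c / 2` of `c`. -/
theorem norm_cexp_ratio_sub_le {c D X R Y t : ℝ} (hc : 0 < c)
    (hY : D ≠ 0 → Y = (X + R) * (c / D)) :
    ‖Complex.exp ((t * Y : ℝ) * Complex.I)
        - Complex.exp ((t * X : ℝ) * Complex.I)‖
      ≤ |t| * (2 * |R| + 2 / c * (|X| * |D - c|)) + 8 / c ^ 2 * (D - c) ^ 2 := by
  by_cases h : |D - c| ≤ c / 2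
  · have hD : c / 2 ≤ D := by linarith [neg_le_of_abs_le h]
    have hD0 : 0 < D := by linarith
    have h1 : c / D ≤ 2 := by rw [div_le_iff₀ hD0]; linarith
    have h2 : |c / D - 1| ≤ 2 / c * |D - c| := by
      have : c / D - 1 = -((D - c) / D) := by field_simp; ring
      rw [this, abs_neg, abs_div, abs_of_pos hD0, div_eq_inv_mul]
      gcongr
      rw [inv_le_comm₀ hD0 (by positivity)]
      simpa using hD
    rw [hY hD0.ne']
    refine (norm_cexp_mul_I_sub_le _ _).trans ?_
    have e : t * ((X + R) * (c / D)) - t * X = t * (R * (c / D) + X * (c / D - 1)) := by ring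
    rw [e, abs_mul]
    have h3 : |R * (c / D) + X * (c / D - 1)| ≤ 2 * |R| + 2 / c * (|X| * |D - c|) := by
      refine (abs_add_le _ _).trans ?_
      rw [abs_mul, abs_mul, abs_of_pos (div_pos hc hD0)]
      have := mul_le_mul_of_nonneg_left h1 (abs_nonneg R)
      have := mul_le_mul_of_nonneg_left h2 (abs_nonneg X)
      linarith
    have := mul_le_mul_of_nonneg_left h3 (abs_nonneg t)
    have : 0 ≤ 8 / c ^ 2 * (D - c) ^ 2 := by positivity
    linarith
  · refine (norm_cexp_mul_I_sub_le_two _ _).trans ?_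
    have h1 : (c / 2) ^ 2 ≤ (D - c) ^ 2 := by
      rw [← sq_abs (D - c)]
      have := (not_le.1 h).le
      gcongr
    have h2 : (2 : ℝ) = 8 / c ^ 2 * (c / 2) ^ 2 := by field_simp; norm_num
    have h3 : (2 : ℝ) ≤ 8 / c ^ 2 * (D - c) ^ 2 := by
      rw [h2]; gcongr
    have : 0 ≤ |t| * (2 * |R| + 2 / c * (|X| * |D - c|)) := by positivity
    linarith

/-- Slutsky's theorem for a ratio, at the level of characteristic functions: `Y = (X + R) c / D`
has the same limit as `X` if `R → 0` in `L¹` and `D → c` in `L²` at the usual rate. As `Y` is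
constrained only where `D ≠ 0`, its value where the denominator vanishes is irrelevant. -/
theorem tendsto_integral_cexp_ratio {Ω : ℕ → Type*} {m : ∀ n, MeasurableSpace (Ω n)}
    {μ : ∀ n, Measure (Ω n)} [∀ n, IsProbabilityMeasure (μ n)] {X R D Y : ∀ n, Ω n → ℝ}
    {c K t : ℝ} {l : ℂ} (hc : 0 < c)
    (hXm : ∀ n, AEMeasurable (X n) (μ n)) (hRm : ∀ n, AEMeasurable (R n) (μ n))
    (hDm : ∀ n, AEMeasurable (D n) (μ n))
    (hYm : ∀ n, AEMeasurable (Y n) (μ n))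
    (hY : ∀ n, ∀ᵐ ω ∂μ n, D n ω ≠ 0 → Y n ω = (X n ω + R n ω) * (c / D n ω))
    (hR : ∀ n, Integrable (R n) (μ n))
    (hX2 : ∀ n, Integrable (fun ω => X n ω ^ 2) (μ n))
    (hD2 : ∀ n, Integrable (fun ω => (D n ω - c) ^ 2) (μ n))
    (hR0 : Tendsto (fun n => ∫ ω, |R n ω| ∂μ n) atTop (𝓝 0))
    (hXK : ∀ n, ∫ ω, X n ω ^ 2 ∂μ n ≤ K)
    (hDK : ∀ n, 0 < n → ∫ ω, (D n ω - c) ^ 2 ∂μ n ≤ K / n)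
    (hX : Tendsto (fun n => ∫ ω, Complex.exp ((t * X n ω : ℝ) * Complex.I) ∂μ n) atTop (𝓝 l)) :
    Tendsto (fun n => ∫ ω, Complex.exp ((t * Y n ω : ℝ) * Complex.I) ∂μ n) atTop (𝓝 l) := by
  have hinv : Tendsto (fun n : ℕ => (√(n : ℝ))⁻¹) atTop (𝓝 0) :=
    tendsto_inv_atTop_zero.comp (Real.tendsto_sqrt_atTop.comp tendsto_natCast_atTop_atTop)
  have hinv' : Tendsto (fun n : ℕ => K / (n : ℝ)) atTop (𝓝 0) :=
    tendsto_const_div_atTop_nhds_zero_nat K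
  set δ : ℕ → ℝ := fun n => |t| * (2 * ∫ ω, |R n ω| ∂μ n) + |t| / c * ((√(n : ℝ))⁻¹ * K)
    + |t| / c * (K * (√(n : ℝ))⁻¹) + 8 / c ^ 2 * (K / n) with hδ
  have hδ0 : Tendsto δ atTop (𝓝 0) := by
    have := (((hR0.const_mul 2).const_mul |t|).add
      ((hinv.mul_const K).const_mul (|t| / c))).add
      ((hinv.const_mul K).const_mul (|t| / c)) |>.add (hinv'.const_mul (8 / c ^ 2))
    simpa using this
  have hdiff : Tendsto (fun n =>
      (∫ ω, Complex.exp ((t * Y n ω : ℝ) * Complex.I) ∂μ n)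
      - ∫ ω, Complex.exp ((t * X n ω : ℝ) * Complex.I) ∂μ n) atTop (𝓝 0) := by
    refine squeeze_zero_norm' ?_ hδ0
    filter_upwards [eventually_gt_atTop 0] with n hn
    have hn' : (0 : ℝ) < n := by exact_mod_cast hn
    have hs : 0 < √(n : ℝ) := Real.sqrt_pos.2 hn'
    have := hXm n
    have := hRm n
    have := hDm n
    have := hYm n
    rw [← integral_sub (integrable_cexp_mul_I (by fun_prop)) (integrable_cexp_mul_I (by fun_prop))]
    refine (norm_integral_le_integral_norm _).trans ?_
    have hbd : ∀ᵐ ω ∂μ n, ‖Complex.exp ((t * Y n ω : ℝ) * Complex.I)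
        - Complex.exp ((t * X n ω : ℝ) * Complex.I)‖
        ≤ |t| * (2 * |R n ω|) + |t| / c * ((√(n : ℝ))⁻¹ * X n ω ^ 2)
          + |t| / c * (√(n : ℝ) * (D n ω - c) ^ 2) + 8 / c ^ 2 * (D n ω - c) ^ 2 := by
      filter_upwards [hY n] with ω hω
      refine (norm_cexp_ratio_sub_le hc hω).trans ?_
      have h1 : 2 * (|X n ω| * |D n ω - c|)
          ≤ (√(n : ℝ))⁻¹ * X n ω ^ 2 + √(n : ℝ) * (D n ω - c) ^ 2 := by
        have h2 : 0 ≤ (√(n : ℝ))⁻¹ * (|X n ω| - √(n : ℝ) * |D n ω - c|) ^ 2 := by positivity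
        have h3 : (√(n : ℝ))⁻¹ * (|X n ω| - √(n : ℝ) * |D n ω - c|) ^ 2
            = (√(n : ℝ))⁻¹ * |X n ω| ^ 2 + √(n : ℝ) * |D n ω - c| ^ 2
              - 2 * (|X n ω| * |D n ω - c|) := by field_simp; ring
        rw [h3, sq_abs, sq_abs] at h2
        linarith
      have h4 := mul_le_mul_of_nonneg_left h1 (show 0 ≤ |t| / c by positivity)
      have h5 : |t| * (2 / c * (|X n ω| * |D n ω - c|))
        = |t| / c * (2 * (|X n ω| * |D n ω - c|)) := by ring
      rw [mul_add, h5]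
      linarith
    have i1 : Integrable (fun ω => |t| * (2 * |R n ω|)) (μ n) :=
      ((hR n).abs.const_mul 2).const_mul _
    have i2 : Integrable (fun ω => |t| / c * ((√(n : ℝ))⁻¹ * X n ω ^ 2)) (μ n) :=
      ((hX2 n).const_mul _).const_mul _
    have i3 : Integrable (fun ω => |t| / c * (√(n : ℝ) * (D n ω - c) ^ 2)) (μ n) :=
      ((hD2 n).const_mul _).const_mul _
    have i4 : Integrable (fun ω => 8 / c ^ 2 * (D n ω - c) ^ 2) (μ n) := (hD2 n).const_mul _
    have i12 : Integrable (fun ω => |t| * (2 * |R n ω|)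
        + |t| / c * ((√(n : ℝ))⁻¹ * X n ω ^ 2)) (μ n) := i1.add i2
    have i123 : Integrable (fun ω => |t| * (2 * |R n ω|) + |t| / c * ((√(n : ℝ))⁻¹ * X n ω ^ 2)
        + |t| / c * (√(n : ℝ) * (D n ω - c) ^ 2)) (μ n) := i12.add i3
    refine (integral_mono_of_nonneg (ae_of_all _ fun ω => norm_nonneg _)
      (i123.add i4) hbd).trans ?_
    refine (integral_add i123 i4).trans_le ?_
    rw [integral_add i12 i3, integral_add i1 i2]
    simp only [integral_const_mul]
    have h6 := hDK n hn
    have h7 : √(n : ℝ) * (K / n) = K * (√(n : ℝ))⁻¹ := by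
      nth_rewrite 2 [← Real.mul_self_sqrt hn'.le]
      field_simp
    rw [hδ]
    simp only
    rw [← h7]
    have := hXK n
    gcongr
  simpa using hdiff.add hX

/-- The central limit theorem for row sums of independent, standardized and uniformly bounded
variables, whose common law may depend on the row. -/
theorem tendsto_integral_cexp_sum {E : Type*} [MeasurableSpace E] {P : ℕ → Measure E}
    [∀ n, IsProbabilityMeasure (P n)] {X : ℕ → E → ℝ} (hXm : ∀ n, Measurable (X n)) {M : ℝ}
    (hM : ∀ n z, |X n z| ≤ M) (h0 : ∀ n, ∫ z, X n z ∂P n = 0) (h1 : ∀ n, ∫ z, X n z ^ 2 ∂P n = 1)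
    (t : ℝ) :
    Tendsto (fun n : ℕ => ∫ y : Fin n → E,
        Complex.exp ((t * ((√(n : ℝ))⁻¹ * ∑ i, X n (y i)) : ℝ) * Complex.I)
          ∂(Measure.pi fun _ => P n)) atTop
      (𝓝 (Complex.exp (-(t ^ 2 / 2 : ℝ)))) := by
  set s : ℕ → ℝ := fun n => t * (√(n : ℝ))⁻¹ with hs
  have hprod : ∀ n : ℕ, (∫ y : Fin n → E,
        Complex.exp ((t * ((√(n : ℝ))⁻¹ * ∑ i, X n (y i)) : ℝ) * Complex.I)
          ∂(Measure.pi fun _ => P n))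
      = (∫ z, Complex.exp ((s n * X n z : ℝ) * Complex.I) ∂P n) ^ n := by
    intro n
    have := integral_fintype_prod_eq_pow (ι := Fin n) (μ := P n)
      (fun z => Complex.exp ((s n * X n z : ℝ) * Complex.I))
    rw [Fintype.card_fin] at this
    rw [← this]
    congr 1
    ext y
    rw [← Complex.exp_sum]
    congr 1
    rw [← Finset.sum_mul]
    congr 1
    rw [hs]
    push_cast
    rw [Finset.mul_sum, Finset.mul_sum]
    refine Finset.sum_congr rfl fun i _ => ?_
    ring
  simp_rw [hprod]
  have hinv : Tendsto (fun n : ℕ => (√(n : ℝ))⁻¹) atTop (𝓝 0) :=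
    tendsto_inv_atTop_zero.comp (Real.tendsto_sqrt_atTop.comp tendsto_natCast_atTop_atTop)
  have hs0 : Tendsto s atTop (𝓝 0) := by simpa using hinv.const_mul t
  have hM0 : 0 ≤ M := by
    obtain ⟨z⟩ : Nonempty E := (P 0).nonempty_of_neZero
    exact (abs_nonneg _).trans (hM 0 z)
  set g : ℕ → ℂ := fun n => (∫ z, Complex.exp ((s n * X n z : ℝ) * Complex.I) ∂P n) - 1 with hg
  have hgb : ∀ n, ‖g n - (-(s n ^ 2 / 2 : ℝ) : ℂ)‖ ≤ |s n| ^ 3 * (M ^ 3 * Real.exp (|s n| * M)) := by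
    intro n
    have := hXm n
    have iX : Integrable (X n) (P n) := integrable_of_abs_le (hXm n).aemeasurable (hM n)
    have iX2 : Integrable (fun z => X n z ^ 2) (P n) := by
      refine integrable_of_abs_le (M := M ^ 2) (by fun_prop) fun z => ?_
      rw [abs_pow]
      exact pow_le_pow_left₀ (abs_nonneg _) (hM n z) 2
    have e : g n - (-(s n ^ 2 / 2 : ℝ) : ℂ)
        = ∫ z, (Complex.exp ((s n * X n z : ℝ) * Complex.I)
          - ((1 : ℂ) + (s n * Complex.I) * (X n z : ℝ) + (-(s n ^ 2 / 2 : ℝ) : ℂ) * (X n z ^ 2 : ℝ)))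
            ∂P n := by
      rw [integral_sub (integrable_cexp_mul_I (by fun_prop)) (by
        exact ((integrable_const _).add (iX.ofReal.const_mul _)).add (iX2.ofReal.const_mul _))]
      rw [integral_add ((integrable_const _).add (iX.ofReal.const_mul _))
        (iX2.ofReal.const_mul _), integral_add (integrable_const _) (iX.ofReal.const_mul _),
        integral_const_mul, integral_const_mul, integral_complex_ofReal, integral_complex_ofReal,
        h0 n, h1 n, hg]
      simp
      ring
    rw [e]
    refine (norm_integral_le_of_norm_le_const (C := |s n| ^ 3 * (M ^ 3 * Real.exp (|s n| * M)))
      (ae_of_all _ fun z => ?_)).trans (by simp)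
    have hb := Complex.norm_exp_sub_sum_le_norm_mul_exp ((s n * X n z : ℝ) * Complex.I) 3
    have hn : ‖((s n * X n z : ℝ) : ℂ) * Complex.I‖ = |s n| * |X n z| := by
      rw [norm_mul, Complex.norm_I, mul_one, Complex.norm_real, Real.norm_eq_abs, abs_mul]
    rw [hn] at hb
    have e2 : ((1 : ℂ) + (s n * Complex.I) * (X n z : ℝ)
        + (-(s n ^ 2 / 2 : ℝ) : ℂ) * (X n z ^ 2 : ℝ))
        = ∑ m ∈ Finset.range 3, (((s n * X n z : ℝ) : ℂ) * Complex.I) ^ m / (m.factorial : ℂ) := by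
      simp [Finset.sum_range_succ, Nat.factorial, mul_pow, Complex.I_sq]
      ring
    rw [e2]
    refine hb.trans ?_
    rw [mul_pow, mul_assoc]
    have := hM n z
    gcongr
  refine (Complex.tendsto_one_add_pow_exp_of_tendsto (g := g) ?_).congr fun n => by simp [hg]
  have hmain : Tendsto (fun n : ℕ => (n : ℂ) * (-(s n ^ 2 / 2 : ℝ) : ℂ)) atTop
      (𝓝 (-(t ^ 2 / 2 : ℝ))) := by
    refine tendsto_const_nhds.congr' ?_
    filter_upwards [eventually_gt_atTop 0] with n hn
    have hn' : (0 : ℝ) < n := by exact_mod_cast hn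
    have : (n : ℝ) * (-(s n ^ 2 / 2)) = -(t ^ 2 / 2) := by
      rw [hs]
      simp only [mul_pow, inv_pow, Real.sq_sqrt hn'.le]
      field_simp
    exact_mod_cast this.symm
  have herr : Tendsto (fun n : ℕ => (n : ℂ) * (g n - (-(s n ^ 2 / 2 : ℝ) : ℂ))) atTop (𝓝 0) := by
    have hz : Tendsto (fun n => t ^ 2 * (|s n| * (M ^ 3 * Real.exp (|s n| * M)))) atTop (𝓝 0) := by
      have ha : Tendsto (fun n => |s n|) atTop (𝓝 0) := by simpa using hs0.abs
      have : Continuous fun x : ℝ => t ^ 2 * (x * (M ^ 3 * Real.exp (x * M))) := by fun_prop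
      simpa [Function.comp_def] using (this.tendsto 0).comp ha
    refine squeeze_zero_norm' ?_ hz
    filter_upwards [eventually_gt_atTop 0] with n hn
    have hn' : (0 : ℝ) < n := by exact_mod_cast hn
    rw [norm_mul, Complex.norm_natCast]
    refine (mul_le_mul_of_nonneg_left (hgb n) hn'.le).trans (le_of_eq ?_)
    have : (n : ℝ) * |s n| ^ 2 = t ^ 2 := by
      rw [sq_abs, hs]
      simp only [mul_pow, inv_pow, Real.sq_sqrt hn'.le]
      field_simp
    rw [← this]
    ring
  have := herr.add hmain
  rw [zero_add] at this
  refine this.congr fun n => ?_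
  ring

/-! ### Resampling a coordinate and second moments under product measures -/

theorem integral_comp_of_measurePreserving {α β : Type*} [MeasurableSpace α] [MeasurableSpace β]
    {μ : Measure α} {ν : Measure β} {f : α → β} (h : MeasurePreserving f μ ν) {g : β → ℝ}
    (hg : Measurable g) : ∫ x, g (f x) ∂μ = ∫ y, g y ∂ν := by
  rw [← h.map_eq, integral_map h.measurable.aemeasurable hg.aestronglyMeasurable]

section Resampling
variable {E : Type*} [MeasurableSpace E] (P : Measure E) [IsProbabilityMeasure P]

/-- Replacing one coordinate of an independent sample by a fresh observation does not change its
law. -/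
theorem measurePreserving_update_pi {ι : Type*} [Fintype ι] [DecidableEq ι] (i : ι) :
    MeasurePreserving (fun p : (ι → E) × E => Function.update p.1 i p.2)
      ((Measure.pi fun _ : ι => P).prod P) (Measure.pi fun _ : ι => P) := by
  have hm : Measurable (fun p : (ι → E) × E => Function.update p.1 i p.2) := by
    refine measurable_pi_lambda _ fun j => ?_
    by_cases h : j = i
    · subst h; simpa using measurable_snd
    · simpa [h, Function.comp_def] using (measurable_pi_apply (X := fun _ : ι => E) j).comp
        (measurable_fst (β := E))
  refine ⟨hm, (Measure.pi_eq fun s hs => ?_).symm⟩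
  rw [Measure.map_apply hm (MeasurableSet.univ_pi hs)]
  have : (fun p : (ι → E) × E => Function.update p.1 i p.2) ⁻¹' (univ.pi s)
      = (univ.pi (Function.update s i univ)) ×ˢ (s i) := by
    ext p
    simp only [mem_preimage, mem_univ_pi, mem_prod]
    constructor
    · intro h
      refine ⟨fun j => ?_, by simpa using h i⟩
      by_cases hj : j = i
      · subst hj; simp
      · simpa [hj] using h j
    · rintro ⟨h, h'⟩ j
      by_cases hj : j = i
      · subst hj; simpa using h'
      · simpa [hj] using h j
  rw [this, Measure.prod_prod, Measure.pi_pi, ← Finset.mul_prod_erase _ _ (Finset.mem_univ i),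
    ← Finset.mul_prod_erase _ (fun j => P (s j)) (Finset.mem_univ i)]
  simp only [Function.update_self, measure_univ, one_mul]
  rw [mul_comm]
  congr 1
  refine Finset.prod_congr rfl fun j hj => ?_
  rw [Function.update_of_ne (Finset.ne_of_mem_erase hj)]

theorem integral_pi_eq_integral_update {ι : Type*} [Fintype ι] [DecidableEq ι] (i : ι)
    {F : (ι → E) → ℝ} (hF : Measurable F) (hFi : Integrable F (Measure.pi fun _ : ι => P)) :
    ∫ y, F y ∂(Measure.pi fun _ : ι => P)
      = ∫ x, ∫ y, F (Function.update y i x) ∂(Measure.pi fun _ : ι => P) ∂P := by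
  have h := measurePreserving_update_pi P i
  have hint : Integrable (fun p : (ι → E) × E => F (Function.update p.1 i p.2))
      ((Measure.pi fun _ : ι => P).prod P) := h.integrable_comp_of_integrable hFi
  rw [← integral_prod_symm _ hint]
  exact (integral_comp_of_measurePreserving h hF).symm

theorem integral_pi_eq_zero_of_update {ι : Type*} [Fintype ι] [DecidableEq ι] (i : ι)
    {F : (ι → E) → ℝ} (hF : Measurable F) (hFi : Integrable F (Measure.pi fun _ : ι => P))
    (h0 : ∀ y, ∫ x, F (Function.update y i x) ∂P = 0) :
    ∫ y, F y ∂(Measure.pi fun _ : ι => P) = 0 := by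
  have h := measurePreserving_update_pi P i
  have hint : Integrable (fun p : (ι → E) × E => F (Function.update p.1 i p.2))
      ((Measure.pi fun _ : ι => P).prod P) := h.integrable_comp_of_integrable hFi
  rw [integral_pi_eq_integral_update P i hF hFi, ← integral_prod_symm _ hint,
    integral_prod _ hint]
  simp [h0]

end Resampling

/-- A second moment bound for a sum of bounded variables in which every variable is orthogonal to
all but at most `k` of the variables. -/
theorem integral_sq_sum_le {Ω ι : Type*} [MeasurableSpace Ω] {μ : Measure Ω}
    [IsProbabilityMeasure μ] {F : ι → Ω → ℝ} (hF : ∀ a, Measurable (F a)) {M : ℝ}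
    (hM : ∀ a ω, |F a ω| ≤ M) (s : Finset ι) (r : ι → Finset ι) {k : ℕ}
    (hk : ∀ a ∈ s, (r a).card ≤ k)
    (h0 : ∀ a ∈ s, ∀ b ∈ s, b ∉ r a → ∫ ω, F a ω * F b ω ∂μ = 0) :
    ∫ ω, (∑ a ∈ s, F a ω) ^ 2 ∂μ ≤ s.card * k * M ^ 2 := by
  classical
  have hM0 : ∀ a ω, |F a ω * F a ω| ≤ M ^ 2 := fun a ω => by
    rw [abs_mul, ← sq]; exact pow_le_pow_left₀ (abs_nonneg _) (hM a ω) 2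
  have hab : ∀ a b ω, |F a ω * F b ω| ≤ M ^ 2 := fun a b ω => by
    rw [abs_mul, sq]
    exact mul_le_mul (hM a ω) (hM b ω) (abs_nonneg _) ((abs_nonneg _).trans (hM a ω))
  have hint : ∀ a b, Integrable (fun ω => F a ω * F b ω) μ := fun a b =>
    integrable_of_abs_le ((hF a).mul (hF b)).aemeasurable (hab a b)
  have e : ∀ ω, (∑ a ∈ s, F a ω) ^ 2 = ∑ a ∈ s, ∑ b ∈ s, F a ω * F b ω := fun ω => by
    rw [sq, Finset.sum_mul_sum]
  simp_rw [e]
  rw [integral_finsetSum _ fun a _ => integrable_finsetSum _ fun b _ => hint a b]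
  have hb : ∀ a ∈ s, ∫ ω, ∑ b ∈ s, F a ω * F b ω ∂μ ≤ k * M ^ 2 := by
    intro a ha
    rw [integral_finsetSum _ fun b _ => hint a b]
    have h1 : ∑ b ∈ s, ∫ ω, F a ω * F b ω ∂μ
        = ∑ b ∈ s.filter (· ∈ r a), ∫ ω, F a ω * F b ω ∂μ := by
      rw [Finset.sum_filter]
      refine Finset.sum_congr rfl fun b hbs => ?_
      split_ifs with h
      · rfl
      · exact h0 a ha b hbs h
    rw [h1]
    have h2 : ∀ b ∈ s.filter (· ∈ r a), ∫ ω, F a ω * F b ω ∂μ ≤ M ^ 2 := fun b _ => by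
      refine (integral_mono (hint a b) (integrable_const (M ^ 2)) fun ω =>
        (le_abs_self _).trans (hab a b ω)).trans (by simp)
    refine (Finset.sum_le_card_nsmul _ _ _ h2).trans ?_
    rw [nsmul_eq_mul]
    have h3 : (s.filter (· ∈ r a)).card ≤ k := by
      refine (Finset.card_le_card fun b hb => ?_).trans (hk a ha)
      exact (Finset.mem_filter.1 hb).2
    gcongr
  refine (Finset.sum_le_card_nsmul _ _ _ hb).trans (le_of_eq ?_)
  rw [nsmul_eq_mul, mul_assoc]

section Moments
variable {E : Type*} [MeasurableSpace E] (P : Measure E) [IsProbabilityMeasure P]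

theorem integral_sq_sum_pi_le {n : ℕ} {X : E → ℝ} (hX : Measurable X) {M : ℝ}
    (hM : ∀ z, |X z| ≤ M) (h0 : ∫ z, X z ∂P = 0) (s : Finset (Fin n)) :
    ∫ y : Fin n → E, (∑ j ∈ s, X (y j)) ^ 2 ∂(Measure.pi fun _ => P) ≤ s.card * M ^ 2 := by
  have := integral_sq_sum_le (μ := Measure.pi fun _ : Fin n => P)
    (F := fun j (y : Fin n → E) => X (y j)) (fun j => hX.comp (measurable_pi_apply j))
    (fun j y => hM (y j)) s (fun j => {j}) (k := 1) (fun a _ => by simp) ?_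
  · simpa using this
  · intro a _ b _ hab
    rw [Finset.mem_singleton] at hab
    have hm : Measurable fun y : Fin n → E => X (y a) * X (y b) := by fun_prop
    refine integral_pi_eq_zero_of_update P a hm
      (integrable_of_abs_le hm.aemeasurable (M := M ^ 2) fun y => ?_) fun y => ?_
    · rw [abs_mul, sq]
      exact mul_le_mul (hM _) (hM _) (abs_nonneg _) ((abs_nonneg _).trans (hM (y a)))
    · simp only [Function.update_self, Function.update_of_ne hab]
      rw [integral_mul_const, h0, zero_mul]

/-- A double sum over an independent sample in a bounded kernel that is degenerate in each of its
variables has second moment of order `n ^ 2` only: off the diagonal, the terms indexed by `(i, j)`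
and `(k, l)` are orthogonal unless `{i, j} = {k, l}`. -/
theorem integral_sq_sum_sum_le {n : ℕ} {K : E → E → ℝ} (hK : Measurable (Function.uncurry K))
    {M : ℝ} (hM : ∀ z z', |K z z'| ≤ M) (h1 : ∀ z', ∫ z, K z z' ∂P = 0)
    (h2 : ∀ z, ∫ z', K z z' ∂P = 0) :
    ∫ y : Fin n → E, (∑ i, ∑ j, K (y i) (y j)) ^ 2 ∂(Measure.pi fun _ => P)
      ≤ 6 * (n : ℝ) ^ 2 * M ^ 2 := by
  classical
  have hKm : ∀ a : Fin n × Fin n, Measurable fun y : Fin n → E => K (y a.1) (y a.2) := fun a =>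
    hK.comp (g := Function.uncurry K) (f := fun y : Fin n → E => (y a.1, y a.2))
      ((measurable_pi_apply a.1).prodMk (measurable_pi_apply a.2))
  have hoff := integral_sq_sum_le (μ := Measure.pi fun _ : Fin n => P)
    (F := fun (a : Fin n × Fin n) (y : Fin n → E) => K (y a.1) (y a.2)) hKm
    (fun a y => hM _ _) (Finset.univ : Finset (Fin n)).offDiag (fun a => {a, a.swap}) (k := 2)
    (fun a _ => Finset.card_le_two) ?_
  · have hint : ∀ (s : Finset (Fin n × Fin n)), Integrable (fun y : Fin n → E =>
        (∑ a ∈ s, K (y a.1) (y a.2)) ^ 2) (Measure.pi fun _ => P) := fun s => by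
      refine integrable_of_abs_le (M := (s.card * M) ^ 2)
        ((Finset.measurable_sum _ fun a _ => hKm a).pow_const 2).aemeasurable fun y => ?_
      rw [abs_pow]
      refine pow_le_pow_left₀ (abs_nonneg _) ?_ 2
      refine (Finset.abs_sum_le_sum_abs _ _).trans ?_
      refine (Finset.sum_le_card_nsmul _ _ M fun a _ => hM _ _).trans (by rw [nsmul_eq_mul])
    have hb : ∀ y : Fin n → E, (∑ i, ∑ j, K (y i) (y j)) ^ 2
        ≤ 2 * (∑ a ∈ (Finset.univ : Finset (Fin n)).offDiag, K (y a.1) (y a.2)) ^ 2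
          + 2 * (n * M) ^ 2 := by
      intro y
      have e : ∑ i, ∑ j, K (y i) (y j)
          = (∑ a ∈ (Finset.univ : Finset (Fin n)).offDiag, K (y a.1) (y a.2))
            + ∑ i, K (y i) (y i) := by
        rw [← Finset.sum_product', ← Finset.diag_union_offDiag,
          Finset.sum_union (Finset.disjoint_diag_offDiag _), Finset.sum_diag, add_comm]
      have hd : (∑ i, K (y i) (y i)) ^ 2 ≤ (n * M) ^ 2 := by
        rw [← sq_abs]
        refine pow_le_pow_left₀ (abs_nonneg _) ?_ 2
        refine (Finset.abs_sum_le_sum_abs _ _).trans ?_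
        refine (Finset.sum_le_card_nsmul _ _ M fun a _ => hM _ _).trans
          (by rw [nsmul_eq_mul]; simp)
      rw [e]
      have := sq_nonneg ((∑ a ∈ (Finset.univ : Finset (Fin n)).offDiag, K (y a.1) (y a.2))
        - ∑ i, K (y i) (y i))
      nlinarith
    refine (integral_mono_of_nonneg (ae_of_all _ fun y => sq_nonneg _)
      (((hint _).const_mul 2).add (integrable_const _)) (ae_of_all _ hb)).trans ?_
    refine (integral_add ((hint _).const_mul 2) (integrable_const _)).trans_le ?_
    rw [integral_const_mul]
    have hc : ((Finset.univ : Finset (Fin n)).offDiag.card : ℝ) ≤ (n : ℝ) ^ 2 := by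
      rw [Finset.offDiag_card]
      have : (Finset.univ : Finset (Fin n)).card * (Finset.univ : Finset (Fin n)).card
        - (Finset.univ : Finset (Fin n)).card ≤ n ^ 2 := by
        simp [sq]
      exact_mod_cast this
    have h3 := mul_le_mul_of_nonneg_right hc (sq_nonneg M)
    push_cast at hoff
    simp only [integral_const, probReal_univ, one_smul]
    nlinarith
  · rintro ⟨i, j⟩ hij ⟨k, l⟩ hkl hn
    have hij' : i ≠ j := by simpa using hij
    have hkl' : k ≠ l := by simpa using hkl
    have hbd : ∀ y : Fin n → E, |K (y i) (y j) * K (y k) (y l)| ≤ M ^ 2 := fun y => by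
      rw [abs_mul, sq]
      exact mul_le_mul (hM _ _) (hM _ _) (abs_nonneg _) ((abs_nonneg _).trans (hM (y i) (y j)))
    have hmm := (hKm (i, j)).mul (hKm (k, l))
    simp only [Finset.mem_insert, Finset.mem_singleton, Prod.swap_prod_mk, Prod.mk.injEq,
      not_or] at hn
    by_cases hi : k ≠ i ∧ l ≠ i
    · refine integral_pi_eq_zero_of_update P i hmm
        (integrable_of_abs_le hmm.aemeasurable hbd) fun y => ?_
      simp only [Function.update_self, Function.update_of_ne hij'.symm,
        Function.update_of_ne hi.1, Function.update_of_ne hi.2]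
      rw [integral_mul_const, h1, zero_mul]
    · have hj : k ≠ j ∧ l ≠ j := by
        grind
      refine integral_pi_eq_zero_of_update P j hmm
        (integrable_of_abs_le hmm.aemeasurable hbd) fun y => ?_
      simp only [Function.update_self, Function.update_of_ne hij',
        Function.update_of_ne hj.1, Function.update_of_ne hj.2]
      rw [integral_mul_const, h2, zero_mul]

end Moments

/-! ### Ranks of a uniform sample -/

/-- The normalized rank of the `i`-th coordinate of `u`: the number of coordinates that are at most
`u i`, divided by `n + 1`. -/
noncomputable def normRank {n : ℕ} (u : Fin n → ℝ) (i : Fin n) : ℝ :=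
  (∑ j, if u j ≤ u i then (1 : ℝ) else 0) / (n + 1)

/-- The uniform law on the unit interval, as a measure on `ℝ`. -/
noncomputable def unifLaw : Measure ℝ := volume.restrict (Icc 0 1)

instance instIsProbabilityMeasureUnifLaw : IsProbabilityMeasure unifLaw := ⟨by simp [unifLaw]⟩

theorem ae_unifLaw_mem_Ioo : ∀ᵐ x ∂unifLaw, x ∈ Ioo (0 : ℝ) 1 := by
  rw [unifLaw, ← restrict_Ioo_eq_restrict_Icc]
  exact ae_restrict_mem measurableSet_Ioo

theorem unifLaw_real_Iic {x : ℝ} (hx : x ∈ Icc (0 : ℝ) 1) : unifLaw.real (Iic x) = x := by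
  rw [unifLaw, measureReal_restrict_apply measurableSet_Iic]
  have : Iic x ∩ Icc (0 : ℝ) 1 = Icc 0 x := by
    ext y; simp only [mem_inter_iff, mem_Iic, mem_Icc]
    exact ⟨fun h => ⟨h.2.1, h.1⟩, fun h => ⟨h.2, h.1, h.2.trans hx.2⟩⟩
  rw [this]
  simp [hx.1]

theorem integral_indicator_le {x : ℝ} (hx : x ∈ Icc (0 : ℝ) 1) :
    ∫ z, (if z ≤ x then (1 : ℝ) else 0) ∂unifLaw = x := by
  have : (fun z : ℝ => if z ≤ x then (1 : ℝ) else 0) = (Iic x).indicator 1 := by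
    ext z; simp [indicator]
  rw [this, integral_indicator_one measurableSet_Iic, unifLaw_real_Iic hx]

/-- A score function on the whole line: `ψ` is bounded by `S` and `B`-Lipschitz, and has derivative
`ψd` on the open unit interval. Outside that interval `ψd` is only required to be measurable and
bounded by `B`. -/
structure SmoothScore (ψ ψd : ℝ → ℝ) (B S : ℝ) : Prop where
  lip : ∀ u v, |ψ u - ψ v| ≤ B * |u - v|
  bdd : ∀ u, |ψ u| ≤ S
  measurable_deriv : Measurable ψd
  deriv_bdd : ∀ u, |ψd u| ≤ B
  hasDerivAt : ∀ u ∈ Ioo (0 : ℝ) 1, HasDerivAt ψ (ψd u) u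

theorem SmoothScore.nonneg {ψ ψd : ℝ → ℝ} {B S : ℝ} (h : SmoothScore ψ ψd B S) : 0 ≤ B :=
  (abs_nonneg _).trans (h.deriv_bdd 0)

theorem SmoothScore.continuous {ψ ψd : ℝ → ℝ} {B S : ℝ} (h : SmoothScore ψ ψd B S) :
    Continuous ψ := by
  have : LipschitzWith B.toNNReal ψ := LipschitzWith.of_dist_le_mul fun u v => by
    rw [Real.dist_eq, Real.dist_eq, Real.coe_toNNReal _ h.nonneg]
    exact h.lip u v
  exact this.continuous

/-- The error of the first-order expansion at `x` of the score, with derivative `ψd`, at `v`. -/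
def taylorErr (ψ ψd : ℝ → ℝ) (x v : ℝ) : ℝ := |ψ v - ψ x - ψd x * (v - x)|

section
variable {ψ ψd : ℝ → ℝ} {B S : ℝ}

theorem SmoothScore.taylorErr_le (h : SmoothScore ψ ψd B S) (x v : ℝ) :
    taylorErr ψ ψd x v ≤ 2 * B * |v - x| := by
  refine (abs_sub _ _).trans ?_
  rw [abs_mul]
  have := h.lip v x
  have := mul_le_mul_of_nonneg_right (h.deriv_bdd x) (abs_nonneg (v - x))
  linarith

theorem SmoothScore.exists_taylorErr_le (h : SmoothScore ψ ψd B S) {x : ℝ}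
    (hx : x ∈ Ioo (0 : ℝ) 1) {ε : ℝ} (hε : 0 < ε) :
    ∃ M, 0 ≤ M ∧ ∀ v, taylorErr ψ ψd x v ≤ ε * |v - x| + M * (v - x) ^ 2 := by
  have hd := (h.hasDerivAt x hx).isLittleO.def hε
  obtain ⟨δ, hδ, hball⟩ := Metric.eventually_nhds_iff.1 hd
  refine ⟨2 * B / δ, div_nonneg (by linarith [h.nonneg]) hδ.le, fun v => ?_⟩
  have hB := h.nonneg
  by_cases hv : |v - x| < δ
  · have h1 := hball (by rwa [Real.dist_eq])
    rw [Real.norm_eq_abs, Real.norm_eq_abs, smul_eq_mul] at h1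
    have : 0 ≤ 2 * B / δ * (v - x) ^ 2 := by positivity
    rw [taylorErr, mul_comm (ψd x)]
    linarith
  · rw [not_lt] at hv
    refine (h.taylorErr_le x v).trans ?_
    have h2 : 2 * B * |v - x| ≤ 2 * B / δ * (v - x) ^ 2 := by
      rw [← sq_abs, sq, ← mul_assoc]
      refine mul_le_mul_of_nonneg_right ?_ (abs_nonneg _)
      rw [div_mul_eq_mul_div, le_div_iff₀ hδ]
      gcongr
    have : 0 ≤ ε * |v - x| := by positivity
    linarith

theorem SmoothScore.measurable_taylorErr (h : SmoothScore ψ ψd B S) :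
    Measurable (Function.uncurry (taylorErr ψ ψd)) := by
  have h1 := h.continuous.measurable
  have h2 := h.measurable_deriv
  unfold taylorErr Function.uncurry
  fun_prop

theorem measurable_normRank {n : ℕ} (i : Fin n) : Measurable fun u : Fin n → ℝ => normRank u i := by
  unfold normRank
  refine (Finset.measurable_sum _ fun j _ => ?_).div_const _
  exact Measurable.ite (measurableSet_le (measurable_pi_apply j) (measurable_pi_apply i))
    measurable_const measurable_const

theorem normRank_mem {n : ℕ} (u : Fin n → ℝ) (i : Fin n) : normRank u i ∈ Icc (0 : ℝ) 1 := by
  constructor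
  · unfold normRank; positivity
  · unfold normRank
    rw [div_le_one (by positivity)]
    refine (Finset.sum_le_card_nsmul _ _ 1 fun j _ => by split_ifs <;> norm_num).trans ?_
    simp

theorem normRank_update_sub {n : ℕ} (u : Fin n → ℝ) (i : Fin n) (x : ℝ) :
    normRank (Function.update u i x) i - x
      = ((1 - 2 * x) + ∑ j ∈ Finset.univ.erase i, ((if u j ≤ x then (1 : ℝ) else 0) - x))
        / (n + 1) := by
  have hn : (n : ℝ) + 1 ≠ 0 := by positivity
  have h1 : 1 ≤ n := by have := i.2; omega
  rw [normRank, ← Finset.add_sum_erase _ _ (Finset.mem_univ i), eq_div_iff hn, sub_mul,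
    div_mul_cancel₀ _ hn, Finset.sum_sub_distrib, Finset.sum_const,
    Finset.card_erase_of_mem (Finset.mem_univ i), Finset.card_univ, Fintype.card_fin, nsmul_eq_mul,
    Nat.cast_sub h1]
  have h2 : ∑ j ∈ Finset.univ.erase i,
      (if Function.update u i x j ≤ Function.update u i x i then (1 : ℝ) else 0)
      = ∑ j ∈ Finset.univ.erase i, (if u j ≤ x then (1 : ℝ) else 0) :=
    Finset.sum_congr rfl fun j hj => by
      rw [Function.update_of_ne (Finset.ne_of_mem_erase hj), Function.update_self]
  rw [h2]
  simp
  ring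

theorem measurable_update_pi {n : ℕ} (i : Fin n) :
    Measurable fun p : (Fin n → ℝ) × ℝ => Function.update p.1 i p.2 :=
  (measurePreserving_update_pi unifLaw i).measurable

theorem measurable_update_right {n : ℕ} (i : Fin n) (x : ℝ) :
    Measurable fun u : Fin n → ℝ => Function.update u i x :=
  (measurable_update_pi i).comp (measurable_id.prodMk measurable_const)

theorem integral_normRank_update_sub_sq_le {n : ℕ} (i : Fin n) {x : ℝ} (hx : x ∈ Icc (0 : ℝ) 1) :
    ∫ u : Fin n → ℝ, (normRank (Function.update u i x) i - x) ^ 2 ∂(Measure.pi fun _ => unifLaw)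
      ≤ 2 / n := by
  have h1 : 1 ≤ n := by have := i.2; omega
  have hn : (1 : ℝ) ≤ n := by exact_mod_cast h1
  have hX : Measurable fun z : ℝ => (if z ≤ x then (1 : ℝ) else 0) - x :=
    (Measurable.ite measurableSet_Iic measurable_const measurable_const).sub_const _
  have hX1 : ∀ z : ℝ, |(if z ≤ x then (1 : ℝ) else 0) - x| ≤ 1 := fun z => by
    rw [abs_le]
    split_ifs <;> constructor <;> linarith [hx.1, hx.2]
  have hX0 : ∫ z, ((if z ≤ x then (1 : ℝ) else 0) - x) ∂unifLaw = 0 := by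
    rw [integral_sub _ (integrable_const _), integral_indicator_le hx]
    · simp
    · refine integrable_of_abs_le (M := 1) (Measurable.ite measurableSet_Iic measurable_const
        measurable_const).aemeasurable fun z => ?_
      split_ifs <;> simp
  have hs := integral_sq_sum_pi_le unifLaw hX hX1 hX0 (Finset.univ.erase i)
  rw [Finset.card_erase_of_mem (Finset.mem_univ i), Finset.card_univ, Fintype.card_fin,
    Nat.cast_sub h1] at hs
  have hint : Integrable (fun u : Fin n → ℝ =>
      (∑ j ∈ Finset.univ.erase i, ((if u j ≤ x then (1 : ℝ) else 0) - x)) ^ 2)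
      (Measure.pi fun _ => unifLaw) := by
    refine integrable_of_abs_le (M := (n : ℝ) ^ 2) ((Finset.measurable_sum _ fun j _ =>
      hX.comp (measurable_pi_apply j)).pow_const 2).aemeasurable fun u => ?_
    rw [abs_pow]
    refine pow_le_pow_left₀ (abs_nonneg _) ?_ 2
    refine (Finset.abs_sum_le_sum_abs _ _).trans ?_
    refine (Finset.sum_le_card_nsmul _ _ 1 fun j _ => hX1 (u j)).trans ?_
    rw [nsmul_eq_mul, mul_one]
    exact_mod_cast (Finset.card_le_univ _).trans (by simp)
  have hb : ∀ u : Fin n → ℝ, (normRank (Function.update u i x) i - x) ^ 2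
      ≤ (((n : ℝ) + 1) ^ 2)⁻¹ * (2 * (∑ j ∈ Finset.univ.erase i,
        ((if u j ≤ x then (1 : ℝ) else 0) - x)) ^ 2 + 2) := fun u => by
    rw [normRank_update_sub, div_pow, div_eq_inv_mul]
    refine mul_le_mul_of_nonneg_left ?_ (by positivity)
    have h2 : (1 - 2 * x) ^ 2 ≤ 1 := by nlinarith [hx.1, hx.2]
    have := sq_nonneg ((1 - 2 * x) - ∑ j ∈ Finset.univ.erase i,
      ((if u j ≤ x then (1 : ℝ) else 0) - x))
    nlinarith
  refine (integral_mono_of_nonneg (ae_of_all _ fun u => sq_nonneg _)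
    (((hint.const_mul 2).add (integrable_const 2)).const_mul _) (ae_of_all _ hb)).trans ?_
  rw [integral_const_mul]
  have e : ∫ u : Fin n → ℝ, (2 * (∑ j ∈ Finset.univ.erase i,
        ((if u j ≤ x then (1 : ℝ) else 0) - x)) ^ 2 + (2 : ℝ)) ∂(Measure.pi fun _ => unifLaw)
          ≤ 2 * (n : ℝ) := by
    rw [integral_add (hint.const_mul 2) (integrable_const 2), integral_const_mul]
    simp only [integral_const, probReal_univ, one_smul]
    push_cast at hs
    linarith
  refine (mul_le_mul_of_nonneg_left e (by positivity)).trans ?_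
  rw [le_div_iff₀ (by linarith), inv_mul_eq_div, div_mul_eq_mul_div, div_le_iff₀ (by positivity)]
  nlinarith

theorem integrable_normRank_update_sub {n : ℕ} (i : Fin n) (x : ℝ) :
    Integrable (fun u : Fin n → ℝ => |normRank (Function.update u i x) i - x|)
        (Measure.pi fun _ => unifLaw) ∧
      Integrable (fun u : Fin n → ℝ => (normRank (Function.update u i x) i - x) ^ 2)
        (Measure.pi fun _ => unifLaw) := by
  have hm := ((measurable_normRank i).comp (measurable_update_right i x)).sub_const x
  have hb : ∀ u : Fin n → ℝ, |normRank (Function.update u i x) i - x| ≤ 1 + |x| := fun u => by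
    refine (abs_sub _ _).trans ?_
    have := normRank_mem (Function.update u i x) i
    rw [abs_of_nonneg this.1]
    linarith [this.2]
  refine ⟨(integrable_of_abs_le hm.aemeasurable hb).abs,
    integrable_of_abs_le (M := (1 + |x|) ^ 2) (hm.pow_const 2).aemeasurable fun u => ?_⟩
  rw [abs_pow]
  exact pow_le_pow_left₀ (abs_nonneg _) (hb u) 2

theorem integral_abs_normRank_update_sub_le {n : ℕ} (i : Fin n) {x : ℝ}
    (hx : x ∈ Icc (0 : ℝ) 1) :
    ∫ u : Fin n → ℝ, |normRank (Function.update u i x) i - x| ∂(Measure.pi fun _ => unifLaw)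
      ≤ 2 / √(n : ℝ) := by
  have hn : (0 : ℝ) < n := by have := i.2; exact_mod_cast (by omega : 0 < n)
  have hs := Real.sqrt_pos.2 hn
  obtain ⟨-, i2⟩ := integrable_normRank_update_sub i x
  have hb : ∀ u : Fin n → ℝ, |normRank (Function.update u i x) i - x|
      ≤ √(n : ℝ) / 2 * (normRank (Function.update u i x) i - x) ^ 2 + 1 / (2 * √(n : ℝ)) := by
    intro u
    rw [← sq_abs]
    set a := |normRank (Function.update u i x) i - x|
    -- the inequality of arithmetic and geometric means, with the weight `√n` that balances both terms
    have h2 : 0 ≤ 1 / (2 * √(n : ℝ)) * (√(n : ℝ) * a - 1) ^ 2 := by positivity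
    have h3 : 1 / (2 * √(n : ℝ)) * (√(n : ℝ) * a - 1) ^ 2
      = √(n : ℝ) / 2 * a ^ 2 + 1 / (2 * √(n : ℝ)) - a := by field_simp; ring
    linarith
  refine (integral_mono_of_nonneg (ae_of_all _ fun u => abs_nonneg _)
    ((i2.const_mul _).add (integrable_const _)) (ae_of_all _ hb)).trans ?_
  refine (integral_add (i2.const_mul _) (integrable_const _)).trans_le ?_
  rw [integral_const_mul]
  simp only [integral_const, probReal_univ, one_smul]
  have h1 := mul_le_mul_of_nonneg_left (integral_normRank_update_sub_sq_le i hx)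
    (show 0 ≤ √(n : ℝ) / 2 by positivity)
  refine (add_le_add_left h1 _).trans ?_
  have h2 : √(n : ℝ) / 2 * (2 / n) = 1 / √(n : ℝ) := by
    nth_rewrite 2 [← Real.mul_self_sqrt hn.le]
    field_simp
  rw [h2, ← sub_nonneg]
  have : 2 / √(n : ℝ) - (1 / √(n : ℝ) + 1 / (2 * √(n : ℝ))) = 1 / (2 * √(n : ℝ)) := by
    field_simp; norm_num
  rw [this]
  positivity

theorem ae_pi_unifLaw_mem {n : ℕ} :
    ∀ᵐ u : Fin n → ℝ ∂(Measure.pi fun _ => unifLaw), ∀ i, u i ∈ Ioo (0 : ℝ) 1 := by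
  rw [ae_all_iff]
  intro i
  exact (measurePreserving_eval (fun _ : Fin n => unifLaw) i).quasiMeasurePreserving.ae
    ae_unifLaw_mem_Ioo

theorem SmoothScore.integrable_taylorErr (h : SmoothScore ψ ψd B S) {n : ℕ} (i : Fin n) :
    Integrable (fun u : Fin n → ℝ => taylorErr ψ ψd (u i) (normRank u i))
      (Measure.pi fun _ => unifLaw) := by
  refine Integrable.of_bound (C := 2 * B) (h.measurable_taylorErr.comp
    ((measurable_pi_apply i).prodMk (measurable_normRank i))).aestronglyMeasurable ?_
  filter_upwards [ae_pi_unifLaw_mem] with u hu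
  rw [Real.norm_eq_abs, taylorErr, abs_abs]
  refine (h.taylorErr_le _ _).trans ?_
  have h1 := normRank_mem u i
  have h2 : |normRank u i - u i| ≤ 1 := by
    rw [abs_le]
    constructor <;> linarith [h1.1, h1.2, (hu i).1, (hu i).2]
  have := mul_le_mul_of_nonneg_left h2 (show 0 ≤ 2 * B by linarith [h.nonneg])
  linarith

/-- The first-order expansion of the scores at the observations is accurate to order `o(√n)` in
total. Conditionally on the `i`-th observation `x`, its normalized rank deviates from `x` by
`O(1 / √n)`, so that differentiability at `x` gives the pointwise limit and the Lipschitz property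
an integrable majorant. -/
theorem SmoothScore.tendsto_taylorErr (h : SmoothScore ψ ψd B S) :
    Tendsto (fun n : ℕ => ∫ u : Fin n → ℝ,
      (√(n : ℝ))⁻¹ * ∑ i, taylorErr ψ ψd (u i) (normRank u i) ∂(Measure.pi fun _ => unifLaw))
      atTop (𝓝 0) := by
  have hB := h.nonneg
  set a : ℕ → ℝ → ℝ := fun n x => (√(n : ℝ))⁻¹ * ∑ i : Fin n, ∫ u : Fin n → ℝ,
    taylorErr ψ ψd x (normRank (Function.update u i x) i) ∂(Measure.pi fun _ => unifLaw) with ha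
  have hF : ∀ {n : ℕ} (i : Fin n), Measurable fun u : Fin n → ℝ =>
      taylorErr ψ ψd (u i) (normRank u i) := fun i =>
    h.measurable_taylorErr.comp ((measurable_pi_apply i).prodMk (measurable_normRank i))
  have hupd : ∀ {n : ℕ} (i : Fin n), Measurable fun p : (Fin n → ℝ) × ℝ =>
      taylorErr ψ ψd p.2 (normRank (Function.update p.1 i p.2) i) := fun i =>
    h.measurable_taylorErr.comp
      (measurable_snd.prodMk ((measurable_normRank i).comp (measurable_update_pi i)))
  have hmeas : ∀ n, StronglyMeasurable (a n) := fun n => by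
    refine (Finset.stronglyMeasurable_fun_sum _ fun i _ => ?_).const_mul _
    exact ((hupd i).stronglyMeasurable).integral_prod_left'
  have hint : ∀ {n : ℕ} (i : Fin n) (x : ℝ), Integrable (fun u : Fin n → ℝ =>
      taylorErr ψ ψd x (normRank (Function.update u i x) i)) (Measure.pi fun _ => unifLaw) := by
    intro n i x
    refine Integrable.mono' ((integrable_normRank_update_sub i x).1.const_mul (2 * B))
      ((hupd i).comp (measurable_id.prodMk measurable_const)).aestronglyMeasurable
      (ae_of_all _ fun u => ?_)
    rw [Real.norm_eq_abs, taylorErr, abs_abs]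
    exact h.taylorErr_le _ _
  have ha0 : ∀ n x, 0 ≤ a n x := fun n x => mul_nonneg (by positivity)
    (Finset.sum_nonneg fun i _ => integral_nonneg fun u => abs_nonneg _)
  -- a bound of order `1 / √n` common to all coordinates survives the sum divided by `√n`; the maximum
  -- with `0` covers the empty sample
  have hsum : ∀ (n : ℕ) (x c : ℝ), (∀ i : Fin n, ∫ u : Fin n → ℝ,
      taylorErr ψ ψd x (normRank (Function.update u i x) i) ∂(Measure.pi fun _ => unifLaw)
        ≤ c / √(n : ℝ)) → a n x ≤ max c 0 := by
    intro n x c hc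
    refine (mul_le_mul_of_nonneg_left (Finset.sum_le_card_nsmul _ _ _ fun i _ => hc i)
      (by positivity)).trans ?_
    rw [Finset.card_univ, Fintype.card_fin, nsmul_eq_mul]
    rcases Nat.eq_zero_or_pos n with rfl | hn
    · simp
    · have hn' : (0 : ℝ) < n := by exact_mod_cast hn
      refine le_trans (le_of_eq ?_) (le_max_left c 0)
      have := Real.mul_self_sqrt hn'.le
      have hs := Real.sqrt_pos.2 hn'
      nth_rewrite 2 [← this]
      field_simp
  have heq : ∀ n : ℕ, (∫ u : Fin n → ℝ,
      (√(n : ℝ))⁻¹ * ∑ i, taylorErr ψ ψd (u i) (normRank u i) ∂(Measure.pi fun _ => unifLaw))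
      = ∫ x, a n x ∂unifLaw := by
    intro n
    simp only [ha]
    rw [integral_const_mul, integral_const_mul, integral_finsetSum _ fun i _ =>
      h.integrable_taylorErr i, integral_finsetSum]
    · congr 1
      refine Finset.sum_congr rfl fun i _ => ?_
      rw [integral_pi_eq_integral_update unifLaw i (hF i) (h.integrable_taylorErr i)]
      simp only [Function.update_self]
    · intro i _
      have := (measurePreserving_update_pi unifLaw i).integrable_comp_of_integrable
        (h.integrable_taylorErr i)
      have := this.integral_prod_right
      simpa only [Function.comp_def, Function.update_self] using this
  simp_rw [heq]
  have hlim : Tendsto (fun n => ∫ x, a n x ∂unifLaw) atTop (𝓝 (∫ x, (0 : ℝ) ∂unifLaw)) := by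
    refine tendsto_integral_of_dominated_convergence (fun _ => 4 * B)
      (fun n => (hmeas n).aestronglyMeasurable) (integrable_const _) (fun n => ?_) ?_
    · filter_upwards [ae_unifLaw_mem_Ioo] with x hx
      rw [Real.norm_eq_abs, abs_of_nonneg (ha0 n x)]
      refine (hsum n x (4 * B) fun i => ?_).trans (by rw [max_eq_left (by linarith)])
      refine (integral_mono (hint i x) ((integrable_normRank_update_sub i x).1.const_mul (2 * B))
        fun u => h.taylorErr_le _ _).trans ?_
      rw [integral_const_mul]
      refine (mul_le_mul_of_nonneg_left (integral_abs_normRank_update_sub_le i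
        (Ioo_subset_Icc_self hx)) (by linarith)).trans (le_of_eq (by ring))
    · filter_upwards [ae_unifLaw_mem_Ioo] with x hx
      rw [Metric.tendsto_atTop']
      intro ε hε
      obtain ⟨M, hM0, hM⟩ := h.exists_taylorErr_le hx (show 0 < ε / 4 by linarith)
      have hlt : Tendsto (fun n : ℕ => 2 * M * (√(n : ℝ))⁻¹) atTop (𝓝 (2 * M * 0)) :=
        (tendsto_inv_atTop_zero.comp
          (Real.tendsto_sqrt_atTop.comp tendsto_natCast_atTop_atTop)).const_mul _
      rw [mul_zero] at hlt
      obtain ⟨N, hN⟩ := eventually_atTop.1 (hlt.eventually_lt_const (show 0 < ε / 4 by linarith))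
      refine ⟨N, fun n hn => ?_⟩
      rw [Real.dist_eq, sub_zero, abs_of_nonneg (ha0 n x)]
      have hNn := hN n hn.le
      refine (hsum n x (ε / 2 + 2 * M * (√(n : ℝ))⁻¹) fun i => ?_).trans_lt ?_
      · obtain ⟨i1, i2⟩ := integrable_normRank_update_sub i x
        refine (integral_mono (hint i x) ((i1.const_mul (ε / 4)).add (i2.const_mul M))
          fun u => hM _).trans ?_
        refine (integral_add (i1.const_mul (ε / 4)) (i2.const_mul M)).trans_le ?_
        rw [integral_const_mul, integral_const_mul]
        have hx' := Ioo_subset_Icc_self hx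
        have j1 := mul_le_mul_of_nonneg_left (integral_abs_normRank_update_sub_le i hx')
          (show 0 ≤ ε / 4 by linarith)
        have j2 := mul_le_mul_of_nonneg_left (integral_normRank_update_sub_sq_le i hx') hM0
        refine (add_le_add j1 j2).trans (le_of_eq ?_)
        have hn' : (0 : ℝ) < n := by have := i.2; exact_mod_cast (by omega : 0 < n)
        have hs := Real.sqrt_pos.2 hn'
        have := Real.mul_self_sqrt hn'.le
        nth_rewrite 2 [← this]
        field_simp
        ring
      · rw [max_lt_iff]
        constructor <;> linarith
  simpa using hlim

/-- The mean score is close in `L²` to the integral of the score function. -/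
theorem SmoothScore.integral_sq_mean_score_sub_le (h : SmoothScore ψ ψd B S) {n : ℕ} (hn : 0 < n) :
    ∫ u : Fin n → ℝ, ((n : ℝ)⁻¹ * ∑ i, ψ (normRank u i) - ∫ x, ψ x ∂unifLaw) ^ 2
      ∂(Measure.pi fun _ => unifLaw) ≤ (4 * B ^ 2 + 8 * S ^ 2) / n := by
  have hn' : (0 : ℝ) < n := by exact_mod_cast hn
  have hψ := h.continuous.measurable
  set c := ∫ x, ψ x ∂unifLaw with hc
  have hψi : Integrable ψ unifLaw := integrable_of_abs_le hψ.aemeasurable h.bdd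
  have hcS : |c| ≤ S := by
    have := norm_integral_le_of_norm_le_const (μ := unifLaw) (f := ψ) (C := S) (ae_of_all _ h.bdd)
    simpa using this
  have hX : Measurable fun x => ψ x - c := by fun_prop
  have hXb : ∀ x, |ψ x - c| ≤ 2 * S := fun x => by
    refine (abs_sub _ _).trans ?_
    linarith [h.bdd x]
  have hX0 : ∫ x, (ψ x - c) ∂unifLaw = 0 := by
    rw [integral_sub hψi (integrable_const _)]
    simp [hc]
  have h1 := integral_sq_sum_pi_le unifLaw hX hXb hX0 (Finset.univ : Finset (Fin n))
  rw [Finset.card_univ, Fintype.card_fin] at h1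
  have hm2 : ∀ i : Fin n, Measurable fun u : Fin n → ℝ => (normRank u i - u i) ^ 2 := fun i =>
    ((measurable_normRank i).sub (measurable_pi_apply i)).pow_const 2
  have hi2 : ∀ i : Fin n, Integrable (fun u : Fin n → ℝ => (normRank u i - u i) ^ 2)
      (Measure.pi fun _ => unifLaw) := fun i => by
    refine Integrable.of_bound (C := 1) (hm2 i).aestronglyMeasurable ?_
    filter_upwards [ae_pi_unifLaw_mem] with u hu
    have h1 := normRank_mem u i
    rw [Real.norm_eq_abs, abs_pow]
    refine pow_le_one₀ (abs_nonneg _) ?_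
    rw [abs_le]
    constructor <;> linarith [h1.1, h1.2, (hu i).1, (hu i).2]
  have hr : ∀ i : Fin n, ∫ u : Fin n → ℝ, (normRank u i - u i) ^ 2
      ∂(Measure.pi fun _ => unifLaw) ≤ 2 / n := fun i => by
    rw [integral_pi_eq_integral_update unifLaw i (hm2 i) (hi2 i)]
    simp only [Function.update_self]
    refine (integral_mono_of_nonneg (g := fun _ => 2 / (n : ℝ))
      (ae_of_all _ fun x => integral_nonneg fun u => sq_nonneg _)
      (integrable_const _) ?_).trans (by simp)
    filter_upwards [ae_unifLaw_mem_Ioo] with x hx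
    exact integral_normRank_update_sub_sq_le i (Ioo_subset_Icc_self hx)
  have hb : ∀ u : Fin n → ℝ, ((n : ℝ)⁻¹ * ∑ i, ψ (normRank u i) - c) ^ 2
      ≤ 2 * B ^ 2 * (n : ℝ)⁻¹ * ∑ i, (normRank u i - u i) ^ 2
        + 2 * ((n : ℝ) ^ 2)⁻¹ * (∑ i, (ψ (u i) - c)) ^ 2 := fun u => by
    have e : (n : ℝ)⁻¹ * ∑ i, ψ (normRank u i) - c
        = (n : ℝ)⁻¹ * (∑ i, (ψ (normRank u i) - ψ (u i)) + ∑ i, (ψ (u i) - c)) := by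
      rw [← Finset.sum_add_distrib]
      simp only [sub_add_sub_cancel]
      rw [Finset.sum_sub_distrib]
      simp
      field_simp
    have h2 : (∑ i, (ψ (normRank u i) - ψ (u i))) ^ 2
        ≤ n * ∑ i, B ^ 2 * (normRank u i - u i) ^ 2 := by
      have := sq_sum_le_card_mul_sum_sq (s := (Finset.univ : Finset (Fin n)))
        (f := fun i => ψ (normRank u i) - ψ (u i))
      rw [Finset.card_univ, Fintype.card_fin] at this
      refine this.trans ?_
      refine mul_le_mul_of_nonneg_left (Finset.sum_le_sum fun i _ => ?_) hn'.le
      rw [← sq_abs, ← sq_abs (normRank u i - u i), ← mul_pow]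
      exact pow_le_pow_left₀ (abs_nonneg _) (h.lip _ _) 2
    rw [← Finset.mul_sum] at h2
    have h3 := sq_nonneg (∑ i, (ψ (normRank u i) - ψ (u i)) - ∑ i, (ψ (u i) - c))
    have h4 : (∑ i, (ψ (normRank u i) - ψ (u i)) + ∑ i, (ψ (u i) - c)) ^ 2
        ≤ 2 * (n * (B ^ 2 * ∑ i, (normRank u i - u i) ^ 2)) + 2 * (∑ i, (ψ (u i) - c)) ^ 2 := by
      nlinarith
    rw [e, mul_pow]
    refine (mul_le_mul_of_nonneg_left h4 (by positivity)).trans (le_of_eq ?_)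
    field_simp
  have k1 : Integrable (fun u : Fin n → ℝ => 2 * B ^ 2 * (n : ℝ)⁻¹ * ∑ i, (normRank u i - u i) ^ 2)
      (Measure.pi fun _ => unifLaw) := (integrable_finsetSum _ fun i _ => hi2 i).const_mul _
  have k2 : Integrable (fun u : Fin n → ℝ => 2 * ((n : ℝ) ^ 2)⁻¹ * (∑ i, (ψ (u i) - c)) ^ 2)
      (Measure.pi fun _ => unifLaw) := by
    refine Integrable.const_mul ?_ _
    refine integrable_of_abs_le (M := (n * (2 * S)) ^ 2)
      ((Finset.measurable_sum _ fun j _ =>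
        hX.comp (measurable_pi_apply j)).pow_const 2).aemeasurable fun u => ?_
    rw [abs_pow]
    refine pow_le_pow_left₀ (abs_nonneg _) ?_ 2
    refine (Finset.abs_sum_le_sum_abs _ _).trans ?_
    refine (Finset.sum_le_card_nsmul _ _ _ fun j _ => hXb (u j)).trans ?_
    simp
  refine (integral_mono_of_nonneg (ae_of_all _ fun u => sq_nonneg _) (k1.add k2)
    (ae_of_all _ hb)).trans ?_
  refine (integral_add k1 k2).trans_le ?_
  rw [integral_const_mul, integral_const_mul, integral_finsetSum _ fun i _ => hi2 i]
  have h5 : ∑ i : Fin n, ∫ u : Fin n → ℝ, (normRank u i - u i) ^ 2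
      ∂(Measure.pi fun _ => unifLaw) ≤ 2 := by
    refine (Finset.sum_le_card_nsmul _ _ _ fun i _ => hr i).trans (le_of_eq ?_)
    rw [Finset.card_univ, Fintype.card_fin, nsmul_eq_mul]
    field_simp
  have h6 := mul_le_mul_of_nonneg_left h5 (show 0 ≤ 2 * B ^ 2 * (n : ℝ)⁻¹ by positivity)
  have h7 := mul_le_mul_of_nonneg_left h1 (show 0 ≤ 2 * ((n : ℝ) ^ 2)⁻¹ by positivity)
  refine (add_le_add h6 h7).trans (le_of_eq ?_)
  field_simp
  ring

end

/-! ### Linearization of weighted rank statistics -/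

/-- The kernel of the double sum that results from expanding `w (y i) * ψ (rank i)` to first order
at `G (y i)`: the effect of the observation `z'` on the term of the observation `z`. -/
noncomputable def rankKernel {E : Type*} (G w : E → ℝ) (ψd : ℝ → ℝ) (z z' : E) : ℝ :=
  w z * ψd (G z) * ((if G z' ≤ G z then 1 else 0) - G z)

/-- The linear terms of the expansion as a double sum in the kernel recentred by `H`. For `H` the
projection of the kernel, only this double sum and two sums of bounded terms remain, all divided by
`n + 1`. -/
theorem sum_weight_mul_normRank_sub {E : Type*} {G w : E → ℝ} {ψd : ℝ → ℝ} {n : ℕ}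
    (H : E → ℝ) (y : Fin n → E) :
    ∑ i, (w (y i) * ψd (G (y i)) * (normRank (fun j => G (y j)) i - G (y i)) - H (y i))
      = (∑ i, ∑ j, (rankKernel G w ψd (y i) (y j) - H (y j))
          - ∑ i, H (y i) - ∑ i, w (y i) * ψd (G (y i)) * G (y i)) / (n + 1) := by
  have hn : (n : ℝ) + 1 ≠ 0 := by positivity
  rw [eq_div_iff hn]
  have h1 : ∀ i, ∑ j, rankKernel G w ψd (y i) (y j)
      = (n + 1) * (w (y i) * ψd (G (y i)) * (normRank (fun j => G (y j)) i - G (y i)))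
        + w (y i) * ψd (G (y i)) * G (y i) := by
    intro i
    unfold rankKernel normRank
    rw [← Finset.mul_sum, Finset.sum_sub_distrib]
    simp only [Finset.sum_const, Finset.card_univ, Fintype.card_fin, nsmul_eq_mul]
    field_simp
    ring
  simp only [Finset.sum_sub_distrib, h1, Finset.sum_add_distrib, ← Finset.mul_sum,
    Finset.sum_const, Finset.card_univ, Fintype.card_fin, nsmul_eq_mul]
  ring

section
variable {E : Type*} [MeasurableSpace E]

/-- A law `P` for one observation, a level function `G` which is uniformly distributed on `[0, 1]`
under `P` and by which the observations are ranked, and a weight `w` bounded by `C`. -/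
structure RankModel (P : Measure E) (G w : E → ℝ) (C : ℝ) : Prop where
  measurable : Measurable G
  mem : ∀ z, G z ∈ Icc (0 : ℝ) 1
  map_eq : P.map G = unifLaw
  measurable_weight : Measurable w
  weight_bdd : ∀ z, |w z| ≤ C

/-- The projection of `rankKernel` on its second variable: the mean effect of the observation `z'`
on the terms of the other observations. -/
noncomputable def rankCorrection (P : Measure E) (G w : E → ℝ) (ψd : ℝ → ℝ) (z' : E) : ℝ :=
  ∫ z, rankKernel G w ψd z z' ∂P

/-- The influence function of the weighted rank statistic: one observation contributes through its
own term and through the ranks of the other observations. -/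
noncomputable def influence (P : Measure E) (G w : E → ℝ) (ψ ψd : ℝ → ℝ) (z : E) : ℝ :=
  w z * ψ (G z) + rankCorrection P G w ψd z

/-- The difference between the weighted rank statistic and the sum of the influence functions, both
divided by `√n`. -/
noncomputable def rankRemainder (P : Measure E) (G w : E → ℝ) (ψ ψd : ℝ → ℝ) (n : ℕ)
    (y : Fin n → E) : ℝ :=
  (√(n : ℝ))⁻¹ * ∑ i, w (y i) * ψ (normRank (fun j => G (y j)) i)
    - (√(n : ℝ))⁻¹ * ∑ i, influence P G w ψ ψd (y i)

variable {P : Measure E} {G w : E → ℝ} {ψ ψd : ℝ → ℝ} {B S C : ℝ}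

namespace RankModel

theorem measurePreserving_pi (m : RankModel P G w C) (n : ℕ) :
    MeasurePreserving (fun (y : Fin n → E) i => G (y i)) (Measure.pi fun _ => P)
      (Measure.pi fun _ => unifLaw) :=
  MeasureTheory.measurePreserving_pi (fun _ : Fin n => P) (fun _ : Fin n => unifLaw)
    (f := fun _ : Fin n => G) fun _ => ⟨m.measurable, m.map_eq⟩

theorem measurable_rankKernel (m : RankModel P G w C) (h : SmoothScore ψ ψd B S) :
    Measurable (Function.uncurry (rankKernel G w ψd)) := by
  have h1 := m.measurable
  have h2 := m.measurable_weight
  have h3 := h.measurable_deriv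
  have h4 : Measurable fun p : E × E => if G p.2 ≤ G p.1 then (1 : ℝ) else 0 :=
    Measurable.ite (measurableSet_le (by fun_prop) (by fun_prop)) measurable_const measurable_const
  unfold rankKernel Function.uncurry
  fun_prop

theorem abs_indicator_sub_le (m : RankModel P G w C) (z z' : E) :
    |(if G z' ≤ G z then (1 : ℝ) else 0) - G z| ≤ 1 := by
  have := m.mem z
  rw [abs_le]
  split_ifs <;> constructor <;> linarith [this.1, this.2]

variable [IsProbabilityMeasure P]

theorem nonneg (m : RankModel P G w C) : 0 ≤ C := by
  obtain ⟨z⟩ : Nonempty E := P.nonempty_of_neZero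
  exact (abs_nonneg _).trans (m.weight_bdd z)

theorem abs_rankKernel_le (m : RankModel P G w C) (h : SmoothScore ψ ψd B S) (z z' : E) :
    |rankKernel G w ψd z z'| ≤ C * B := by
  rw [rankKernel, abs_mul, abs_mul]
  have h1 := mul_le_mul (m.weight_bdd z) (h.deriv_bdd (G z)) (abs_nonneg _) m.nonneg
  have := mul_le_mul h1 (m.abs_indicator_sub_le z z') (abs_nonneg _)
    (mul_nonneg m.nonneg h.nonneg)
  simpa using this

theorem integral_rankKernel_right (m : RankModel P G w C) (ψd : ℝ → ℝ) (z : E) :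
    ∫ z', rankKernel G w ψd z z' ∂P = 0 := by
  have hmp : MeasurePreserving G P unifLaw := ⟨m.measurable, m.map_eq⟩
  have hm : Measurable fun x : ℝ => if x ≤ G z then (1 : ℝ) else 0 :=
    Measurable.ite measurableSet_Iic measurable_const measurable_const
  have h1 := integral_comp_of_measurePreserving hmp hm
  rw [integral_indicator_le (m.mem z)] at h1
  unfold rankKernel
  rw [integral_const_mul, integral_sub _ (integrable_const _), h1]
  · simp
  · refine integrable_of_abs_le (M := 1) (hm.comp m.measurable).aemeasurable fun z' => ?_
    split_ifs <;> simp

theorem measurable_rankCorrection (m : RankModel P G w C) (h : SmoothScore ψ ψd B S) :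
    Measurable (rankCorrection P G w ψd) :=
  ((m.measurable_rankKernel h).stronglyMeasurable.integral_prod_left').measurable

theorem abs_rankCorrection_le (m : RankModel P G w C) (h : SmoothScore ψ ψd B S) (z : E) :
    |rankCorrection P G w ψd z| ≤ C * B := by
  have := norm_integral_le_of_norm_le_const (μ := P) (f := fun z' => rankKernel G w ψd z' z)
    (C := C * B) (ae_of_all _ fun z' => m.abs_rankKernel_le h z' z)
  simpa [rankCorrection] using this

theorem integrable_rankKernel_prod (m : RankModel P G w C) (h : SmoothScore ψ ψd B S) :
    Integrable (Function.uncurry (rankKernel G w ψd)) (P.prod P) :=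
  integrable_of_abs_le (m.measurable_rankKernel h).aemeasurable
    fun p => m.abs_rankKernel_le h p.1 p.2

theorem integral_rankCorrection (m : RankModel P G w C) (h : SmoothScore ψ ψd B S) :
    ∫ z, rankCorrection P G w ψd z ∂P = 0 := by
  have := integral_integral_swap (m.integrable_rankKernel_prod h)
  unfold rankCorrection
  rw [← this]
  simp [m.integral_rankKernel_right]

theorem integrable_rankCorrection (m : RankModel P G w C) (h : SmoothScore ψ ψd B S) :
    Integrable (rankCorrection P G w ψd) P :=
  integrable_of_abs_le (m.measurable_rankCorrection h).aemeasurable (m.abs_rankCorrection_le h)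

theorem measurable_influence (m : RankModel P G w C) (h : SmoothScore ψ ψd B S) :
    Measurable (influence P G w ψ ψd) :=
  (m.measurable_weight.mul (h.continuous.measurable.comp m.measurable)).add
    (m.measurable_rankCorrection h)

theorem abs_weight_mul_score_le (m : RankModel P G w C) (h : SmoothScore ψ ψd B S) (z : E) (x : ℝ) :
    |w z * ψ x| ≤ C * S := by
  rw [abs_mul]
  exact mul_le_mul (m.weight_bdd z) (h.bdd _) (abs_nonneg _) m.nonneg

theorem abs_influence_le (m : RankModel P G w C) (h : SmoothScore ψ ψd B S) (z : E) :
    |influence P G w ψ ψd z| ≤ C * S + C * B :=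
  (abs_add_le _ _).trans (add_le_add (m.abs_weight_mul_score_le h z _)
    (m.abs_rankCorrection_le h z))

theorem integral_influence (m : RankModel P G w C) (h : SmoothScore ψ ψd B S) :
    ∫ z, influence P G w ψ ψd z ∂P = ∫ z, w z * ψ (G z) ∂P := by
  unfold influence
  rw [integral_add _ (m.integrable_rankCorrection h), m.integral_rankCorrection h, add_zero]
  exact integrable_of_abs_le (m.measurable_weight.mul
    (h.continuous.measurable.comp m.measurable)).aemeasurable
    fun z => m.abs_weight_mul_score_le h z _

theorem integral_sq_sum_centred_rankKernel_le (m : RankModel P G w C) (h : SmoothScore ψ ψd B S)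
    (n : ℕ) :
    ∫ y : Fin n → E, (∑ i, ∑ j, (rankKernel G w ψd (y i) (y j) - rankCorrection P G w ψd (y j))) ^ 2
      ∂(Measure.pi fun _ => P) ≤ 24 * (n : ℝ) ^ 2 * (C * B) ^ 2 := by
  have := integral_sq_sum_sum_le P (n := n) (M := 2 * (C * B))
    (K := fun z z' => rankKernel G w ψd z z' - rankCorrection P G w ψd z')
    ((m.measurable_rankKernel h).sub ((m.measurable_rankCorrection h).comp measurable_snd))
    (fun z z' => (abs_sub _ _).trans
      (by linarith [m.abs_rankKernel_le h z z', m.abs_rankCorrection_le h z'])) ?_ ?_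
  · refine this.trans (le_of_eq (by ring))
  · intro z'
    rw [integral_sub _ (integrable_const _)]
    · simp [rankCorrection]
    · exact integrable_of_abs_le ((m.measurable_rankKernel h).comp
        (measurable_id.prodMk measurable_const)).aemeasurable fun z => m.abs_rankKernel_le h z z'
  · intro z
    rw [integral_sub _ (m.integrable_rankCorrection h), m.integral_rankCorrection h,
      m.integral_rankKernel_right, sub_zero]
    exact integrable_of_abs_le ((m.measurable_rankKernel h).comp
        (measurable_const.prodMk measurable_id)).aemeasurable fun z' => m.abs_rankKernel_le h z z'

theorem abs_rankRemainder_le (m : RankModel P G w C) (h : SmoothScore ψ ψd B S) {n : ℕ}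
    (hn : 0 < n) (y : Fin n → E) :
    |rankRemainder P G w ψ ψd n y|
      ≤ C * ((√(n : ℝ))⁻¹ * ∑ i, taylorErr ψ ψd (G (y i)) (normRank (fun j => G (y j)) i))
        + (√(n : ℝ))⁻¹ * ((1 + (∑ i, ∑ j, (rankKernel G w ψd (y i) (y j)
          - rankCorrection P G w ψd (y j))) ^ 2 / (n : ℝ) ^ 2) / 2 + 2 * (C * B)) := by
  have hn' : (0 : ℝ) < n := by exact_mod_cast hn
  have hC := m.nonneg
  set Q := ∑ i, ∑ j, (rankKernel G w ψd (y i) (y j) - rankCorrection P G w ψd (y j)) with hQ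
  have e : rankRemainder P G w ψ ψd n y = (√(n : ℝ))⁻¹ *
      (∑ i, w (y i) * (ψ (normRank (fun j => G (y j)) i) - ψ (G (y i))
          - ψd (G (y i)) * (normRank (fun j => G (y j)) i - G (y i)))
      + ∑ i, (w (y i) * ψd (G (y i)) * (normRank (fun j => G (y j)) i - G (y i))
          - rankCorrection P G w ψd (y i))) := by
    rw [rankRemainder, ← mul_sub, ← Finset.sum_sub_distrib, ← Finset.sum_add_distrib]
    congr 1
    refine Finset.sum_congr rfl fun i _ => ?_
    rw [influence]
    ring
  rw [e, sum_weight_mul_normRank_sub, ← hQ, abs_mul, abs_of_nonneg (by positivity), mul_left_comm,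
    ← mul_add]
  refine mul_le_mul_of_nonneg_left ((abs_add_le _ _).trans (add_le_add ?_ ?_)) (by positivity)
  · rw [Finset.mul_sum]
    refine (Finset.abs_sum_le_sum_abs _ _).trans (Finset.sum_le_sum fun i _ => ?_)
    rw [abs_mul]
    exact mul_le_mul_of_nonneg_right (m.weight_bdd _) (abs_nonneg _)
  · have b1 : |∑ i, rankCorrection P G w ψd (y i)| ≤ n * (C * B) := by
      refine (Finset.abs_sum_le_sum_abs _ _).trans ?_
      refine (Finset.sum_le_card_nsmul _ _ _ fun i _ => m.abs_rankCorrection_le h (y i)).trans ?_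
      simp
    have b2 : |∑ i, w (y i) * ψd (G (y i)) * G (y i)| ≤ n * (C * B) := by
      refine (Finset.abs_sum_le_sum_abs _ _).trans ?_
      refine (Finset.sum_le_card_nsmul _ _ (C * B) fun i _ => ?_).trans (by simp)
      rw [abs_mul, abs_mul]
      have h1 := mul_le_mul (m.weight_bdd (y i)) (h.deriv_bdd (G (y i))) (abs_nonneg _) hC
      have h2 : |G (y i)| ≤ 1 := abs_le.2 ⟨by linarith [(m.mem (y i)).1], (m.mem (y i)).2⟩
      have := mul_le_mul h1 h2 (abs_nonneg _) (mul_nonneg hC h.nonneg)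
      simpa using this
    rw [abs_div, abs_of_pos (by positivity : (0 : ℝ) < n + 1), div_le_iff₀ (by positivity)]
    have b3 : |Q| ≤ (1 + Q ^ 2 / (n : ℝ) ^ 2) / 2 * n := by
      have h1 : (1 + Q ^ 2 / (n : ℝ) ^ 2) / 2 * n - |Q| = (n - |Q|) ^ 2 / (2 * n) := by
        rw [← sq_abs Q]; field_simp; ring
      have : 0 ≤ (n - |Q|) ^ 2 / (2 * n) := by positivity
      linarith
    have b4 : |Q - ∑ i, rankCorrection P G w ψd (y i) - ∑ i, w (y i) * ψd (G (y i)) * G (y i)|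
        ≤ |Q| + |∑ i, rankCorrection P G w ψd (y i)|
          + |∑ i, w (y i) * ψd (G (y i)) * G (y i)| :=
      (abs_sub _ _).trans (by linarith [abs_sub Q (∑ i, rankCorrection P G w ψd (y i))])
    have b5 : 0 ≤ (1 + Q ^ 2 / (n : ℝ) ^ 2) / 2 := by positivity
    have b6 := mul_nonneg hC h.nonneg
    nlinarith

theorem measurable_rankRemainder (m : RankModel P G w C) (h : SmoothScore ψ ψd B S) (n : ℕ) :
    Measurable (rankRemainder P G w ψ ψd n) := by
  unfold rankRemainder
  refine (Measurable.const_mul (Finset.measurable_sum _ fun i _ => ?_) _).sub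
    (Measurable.const_mul (Finset.measurable_sum _ fun i _ => ?_) _)
  · exact (m.measurable_weight.comp (measurable_pi_apply i)).mul
      (h.continuous.measurable.comp ((measurable_normRank i).comp
        (m.measurePreserving_pi n).measurable))
  · exact (m.measurable_influence h).comp (measurable_pi_apply i)

theorem integrable_rankRemainder (m : RankModel P G w C) (h : SmoothScore ψ ψd B S) (n : ℕ) :
    Integrable (rankRemainder P G w ψ ψd n) (Measure.pi fun _ => P) := by
  refine integrable_of_abs_le (M := (√(n : ℝ))⁻¹ * (n * (C * S))
    + (√(n : ℝ))⁻¹ * (n * (C * S + C * B))) (m.measurable_rankRemainder h n).aemeasurable fun y => ?_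
  refine (abs_sub _ _).trans (add_le_add ?_ ?_)
  · rw [abs_mul, abs_of_nonneg (by positivity)]
    refine mul_le_mul_of_nonneg_left ?_ (by positivity)
    refine (Finset.abs_sum_le_sum_abs _ _).trans ?_
    exact (Finset.sum_le_card_nsmul _ _ _ fun i _ =>
      m.abs_weight_mul_score_le h (y i) _).trans (by simp)
  · rw [abs_mul, abs_of_nonneg (by positivity)]
    refine mul_le_mul_of_nonneg_left ?_ (by positivity)
    refine (Finset.abs_sum_le_sum_abs _ _).trans ?_
    exact (Finset.sum_le_card_nsmul _ _ _ fun i _ => m.abs_influence_le h (y i)).trans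
      (by rw [Finset.card_univ, Fintype.card_fin, nsmul_eq_mul])

theorem integral_abs_rankRemainder_le (m : RankModel P G w C) (h : SmoothScore ψ ψd B S) {n : ℕ}
    (hn : 0 < n) :
    ∫ y, |rankRemainder P G w ψ ψd n y| ∂(Measure.pi fun _ => P)
      ≤ C * (∫ u : Fin n → ℝ, (√(n : ℝ))⁻¹ * ∑ i, taylorErr ψ ψd (u i) (normRank u i)
          ∂(Measure.pi fun _ => unifLaw))
        + (√(n : ℝ))⁻¹ * ((1 + 24 * (C * B) ^ 2) / 2 + 2 * (C * B)) := by
  have hn' : (0 : ℝ) < n := by exact_mod_cast hn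
  have hmp := m.measurePreserving_pi n
  have hT : Measurable fun u : Fin n → ℝ =>
      (√(n : ℝ))⁻¹ * ∑ i, taylorErr ψ ψd (u i) (normRank u i) :=
    Measurable.const_mul (Finset.measurable_sum _ fun i _ =>
      h.measurable_taylorErr.comp ((measurable_pi_apply i).prodMk (measurable_normRank i))) _
  have hTi : Integrable (fun u : Fin n → ℝ =>
      (√(n : ℝ))⁻¹ * ∑ i, taylorErr ψ ψd (u i) (normRank u i)) (Measure.pi fun _ => unifLaw) :=
    (integrable_finsetSum _ fun i _ => h.integrable_taylorErr i).const_mul _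
  have e1 := integral_comp_of_measurePreserving hmp hT
  have i1 := hmp.integrable_comp_of_integrable hTi
  set Q : (Fin n → E) → ℝ := fun y => ∑ i, ∑ j, (rankKernel G w ψd (y i) (y j)
    - rankCorrection P G w ψd (y j)) with hQ
  have hQm : Measurable Q := Finset.measurable_sum _ fun i _ => Finset.measurable_sum _ fun j _ =>
    ((m.measurable_rankKernel h).comp (g := Function.uncurry (rankKernel G w ψd))
      (f := fun y : Fin n → E => (y i, y j))
      ((measurable_pi_apply i).prodMk (measurable_pi_apply j))).sub
      ((m.measurable_rankCorrection h).comp (measurable_pi_apply j))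
  have hQi : Integrable (fun y => Q y ^ 2) (Measure.pi fun _ => P) := by
    refine integrable_of_abs_le (M := (n * (n * (2 * (C * B)))) ^ 2)
      (hQm.pow_const 2).aemeasurable fun y => ?_
    rw [abs_pow]
    refine pow_le_pow_left₀ (abs_nonneg _) ?_ 2
    refine (Finset.abs_sum_le_sum_abs _ _).trans ?_
    refine (Finset.sum_le_card_nsmul _ _ (n * (2 * (C * B))) fun i _ => ?_).trans (by simp)
    refine (Finset.abs_sum_le_sum_abs _ _).trans ?_
    refine (Finset.sum_le_card_nsmul _ _ (2 * (C * B)) fun j _ => ?_).trans (by simp)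
    refine (abs_sub _ _).trans ?_
    linarith [m.abs_rankKernel_le h (y i) (y j), m.abs_rankCorrection_le h (y j)]
  have i3 : Integrable (fun y => 1 + Q y ^ 2 / (n : ℝ) ^ 2) (Measure.pi fun _ => P) :=
    (integrable_const _).add (hQi.div_const _)
  have i2 : Integrable (fun y => (√(n : ℝ))⁻¹ * ((1 + Q y ^ 2 / (n : ℝ) ^ 2) / 2 + 2 * (C * B)))
      (Measure.pi fun _ => P) :=
    ((i3.div_const 2).add (integrable_const _)).const_mul _
  refine (integral_mono (m.integrable_rankRemainder h n).abs ((i1.const_mul C).add i2)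
    fun y => m.abs_rankRemainder_le h hn y).trans ?_
  refine (integral_add (i1.const_mul C) i2).trans_le (add_le_add ?_ ?_)
  · rw [integral_const_mul]
    simp only [Function.comp_def]
    rw [e1]
  · rw [integral_const_mul]
    refine mul_le_mul_of_nonneg_left ?_ (by positivity)
    rw [integral_add (i3.div_const 2) (integrable_const _),
      integral_div, integral_add (integrable_const _) (hQi.div_const _), integral_div]
    have := m.integral_sq_sum_centred_rankKernel_le h n
    have h2 : (∫ y, Q y ^ 2 ∂(Measure.pi fun _ => P)) / (n : ℝ) ^ 2 ≤ 24 * (C * B) ^ 2 := by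
      rw [div_le_iff₀ (by positivity)]
      linarith
    simp only [integral_const, probReal_univ, one_smul]
    linarith

end RankModel

/-- Asymptotic normality of centred weighted rank statistics for models that may vary with the
sample size, provided the variance of the influence function stays away from zero. -/
theorem tendsto_integral_cexp_rankStatistic {P : ℕ → Measure E} [∀ n, IsProbabilityMeasure (P n)]
    {G w : ℕ → E → ℝ} (m : ∀ n, RankModel (P n) (G n) (w n) C) (h : SmoothScore ψ ψd B S)
    (hc : 0 < ∫ x, ψ x ∂unifLaw) (h0 : ∀ n, ∫ z, w n z * ψ (G n z) ∂P n = 0) {v : ℝ} (hv : 0 < v)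
    (hτ : ∀ n, v ≤ ∫ z, influence (P n) (G n) (w n) ψ ψd z ^ 2 ∂P n)
    {Y : ∀ n : ℕ, (Fin n → E) → ℝ} (hYm : ∀ n, AEMeasurable (Y n) (Measure.pi fun _ => P n))
    (hY : ∀ n, ∀ᵐ y ∂(Measure.pi fun _ : Fin n => P n),
      ∑ i, ψ (normRank (fun j => G n (y j)) i) ≠ 0 → Y n y = √(n : ℝ) *
        ((∑ i, w n (y i) * ψ (normRank (fun j => G n (y j)) i))
          / ∑ i, ψ (normRank (fun j => G n (y j)) i))
        * ((∫ x, ψ x ∂unifLaw) / √(∫ z, influence (P n) (G n) (w n) ψ ψd z ^ 2 ∂P n)))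
    (t : ℝ) :
    Tendsto (fun n : ℕ => ∫ y : Fin n → E, Complex.exp ((t * Y n y : ℝ) * Complex.I)
      ∂(Measure.pi fun _ => P n)) atTop
      (𝓝 (Complex.exp (-(t ^ 2 / 2 : ℝ)))) := by
  set c := ∫ x, ψ x ∂unifLaw with hcdef
  set τ : ℕ → ℝ := fun n => √(∫ z, influence (P n) (G n) (w n) ψ ψd z ^ 2 ∂P n) with hτdef
  have hvs : 0 < √v := Real.sqrt_pos.2 hv
  have hτv : ∀ n, √v ≤ τ n := fun n => Real.sqrt_le_sqrt (hτ n)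
  have hτ0 : ∀ n, 0 < τ n := fun n => hvs.trans_le (hτv n)
  have hC := (m 0).nonneg
  have hS : 0 ≤ S := (abs_nonneg _).trans (h.bdd 0)
  have hB := h.nonneg
  set X : ℕ → E → ℝ := fun n z => influence (P n) (G n) (w n) ψ ψd z / τ n with hX
  have hXm : ∀ n, Measurable (X n) := fun n => ((m n).measurable_influence h).div_const _
  have hXb : ∀ n z, |X n z| ≤ (C * S + C * B) / √v := fun n z => by
    rw [hX, abs_div, abs_of_pos (hτ0 n)]
    have := (m n).abs_influence_le h z
    have := hτv n
    gcongr
  have hX0 : ∀ n, ∫ z, X n z ∂P n = 0 := fun n => by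
    simp only [hX]
    rw [integral_div, (m n).integral_influence h, h0 n, zero_div]
  have hX1 : ∀ n, ∫ z, X n z ^ 2 ∂P n = 1 := fun n => by
    simp only [hX, div_pow]
    rw [integral_div, hτdef]
    simp only
    rw [Real.sq_sqrt (hv.le.trans (hτ n)), div_self (hv.trans_le (hτ n)).ne']
  have hclt := tendsto_integral_cexp_sum hXm hXb hX0 hX1 t
  have hRankm : ∀ n (i : Fin n), Measurable fun y : Fin n → E =>
      ψ (normRank (fun j => G n (y j)) i) := fun n i =>
    h.continuous.measurable.comp ((measurable_normRank i).comp
        ((m n).measurePreserving_pi n).measurable)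
  have hsm : ∀ n, Measurable fun y : Fin n → E => (√(n : ℝ))⁻¹ * ∑ i, X n (y i) := fun n =>
    (Finset.measurable_sum _ fun i _ => (hXm n).comp (measurable_pi_apply i)).const_mul _
  have hDm : ∀ n, Measurable fun y : Fin n → E =>
      (n : ℝ)⁻¹ * ∑ i, ψ (normRank (fun j => G n (y j)) i) := fun n =>
    (Finset.measurable_sum _ fun i _ => hRankm n i).const_mul _
  have hinv : Tendsto (fun n : ℕ => (√(n : ℝ))⁻¹) atTop (𝓝 0) :=
    tendsto_inv_atTop_zero.comp (Real.tendsto_sqrt_atTop.comp tendsto_natCast_atTop_atTop)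
  have hR0 : Tendsto (fun n => ∫ y, |rankRemainder (P n) (G n) (w n) ψ ψd n y / τ n|
      ∂(Measure.pi fun _ => P n)) atTop (𝓝 0) := by
    have hlim := ((h.tendsto_taylorErr.const_mul C).add
      (hinv.mul_const ((1 + 24 * (C * B) ^ 2) / 2 + 2 * (C * B)))).div_const (√v)
    rw [mul_zero, zero_mul, add_zero, zero_div] at hlim
    refine squeeze_zero' (Eventually.of_forall fun n => integral_nonneg fun y => abs_nonneg _) ?_ hlim
    filter_upwards [eventually_gt_atTop 0] with n hn
    simp only [abs_div]
    rw [integral_div, abs_of_pos (hτ0 n)]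
    have h1 := (m n).integral_abs_rankRemainder_le h hn
    have h2 : 0 ≤ ∫ y, |rankRemainder (P n) (G n) (w n) ψ ψd n y| ∂(Measure.pi fun _ => P n) :=
      integral_nonneg fun y => abs_nonneg _
    exact div_le_div₀ (h2.trans h1) h1 hvs (hτv n)
  set K : ℝ := max 1 (4 * B ^ 2 + 8 * S ^ 2) + ((C * S + C * B) / √v) ^ 2 with hK
  refine tendsto_integral_cexp_ratio (μ := fun n => Measure.pi fun _ : Fin n => P n)
    (X := fun n y => (√(n : ℝ))⁻¹ * ∑ i, X n (y i))
    (R := fun n y => rankRemainder (P n) (G n) (w n) ψ ψd n y / τ n)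
    (D := fun n y => (n : ℝ)⁻¹ * ∑ i, ψ (normRank (fun j => G n (y j)) i))
    (c := c) (K := K) (t := t) hc (fun n => (hsm n).aemeasurable)
    (fun n => (((m n).measurable_rankRemainder h n).div_const _).aemeasurable)
    (fun n => (hDm n).aemeasurable) hYm ?_
    (fun n => ((m n).integrable_rankRemainder h n).div_const _) ?_ ?_ hR0 ?_ ?_ hclt
  · intro n
    filter_upwards [hY n] with y hy hD
    rw [hy (right_ne_zero_of_mul hD)]
    have e1 : (√(n : ℝ))⁻¹ * ∑ i, X n (y i) + rankRemainder (P n) (G n) (w n) ψ ψd n y / τ n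
        = (√(n : ℝ))⁻¹ * (∑ i, w n (y i) * ψ (normRank (fun j => G n (y j)) i)) / τ n := by
      rw [rankRemainder, sub_div, hX]
      simp only
      rw [← Finset.sum_div]
      ring
    rw [e1]
    rcases Nat.eq_zero_or_pos n with rfl | hn
    · simp
    · have hn' : (0 : ℝ) < n := by exact_mod_cast hn
      have hs := Real.sqrt_pos.2 hn'
      have e2 : (√(n : ℝ))⁻¹ = √(n : ℝ) * (n : ℝ)⁻¹ := by
        nth_rewrite 3 [← Real.mul_self_sqrt hn'.le]
        field_simp
      rw [e2, div_eq_mul_inv, div_eq_mul_inv, div_eq_mul_inv, div_eq_mul_inv, mul_inv, inv_inv]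
      field_simp
      rfl
  · intro n
    refine integrable_of_abs_le (M := ((√(n : ℝ))⁻¹ * (n * ((C * S + C * B) / √v))) ^ 2)
      ((hsm n).pow_const 2).aemeasurable fun y => ?_
    rw [abs_pow]
    refine pow_le_pow_left₀ (abs_nonneg _) ?_ 2
    rw [abs_mul, abs_of_nonneg (by positivity)]
    refine mul_le_mul_of_nonneg_left ?_ (by positivity)
    refine (Finset.abs_sum_le_sum_abs _ _).trans ?_
    exact (Finset.sum_le_card_nsmul _ _ _ fun i _ => hXb n (y i)).trans (by simp)
  · intro n
    refine integrable_of_abs_le (M := ((n : ℝ)⁻¹ * (n * S) + |c|) ^ 2)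
      (((hDm n).sub_const c).pow_const 2).aemeasurable fun y => ?_
    rw [abs_pow]
    refine pow_le_pow_left₀ (abs_nonneg _) ?_ 2
    refine (abs_sub _ _).trans (add_le_add ?_ le_rfl)
    rw [abs_mul, abs_of_nonneg (by positivity)]
    refine mul_le_mul_of_nonneg_left ?_ (by positivity)
    refine (Finset.abs_sum_le_sum_abs _ _).trans ?_
    exact (Finset.sum_le_card_nsmul _ _ _ fun i _ => h.bdd _).trans (by simp)
  · intro n
    simp only [mul_pow]
    rw [integral_const_mul]
    have h1 := integral_sq_sum_pi_le (P n) (hXm n) (hXb n) (hX0 n) (Finset.univ : Finset (Fin n))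
    rw [Finset.card_univ, Fintype.card_fin] at h1
    refine (mul_le_mul_of_nonneg_left h1 (by positivity)).trans ?_
    rw [inv_pow, Real.sq_sqrt (Nat.cast_nonneg n), ← mul_assoc]
    have h2 : (n : ℝ)⁻¹ * n ≤ 1 := inv_mul_le_one
    have h3 := mul_le_mul_of_nonneg_right h2 (sq_nonneg ((C * S + C * B) / √v))
    have h4 := le_max_left 1 (4 * B ^ 2 + 8 * S ^ 2)
    rw [hK]
    linarith
  · intro n hn
    have hT : Measurable fun u : Fin n → ℝ =>
        ((n : ℝ)⁻¹ * ∑ i, ψ (normRank u i) - c) ^ 2 :=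
      (((Finset.measurable_sum _ fun i _ => h.continuous.measurable.comp
        (measurable_normRank i)).const_mul _).sub_const c).pow_const 2
    have e := integral_comp_of_measurePreserving ((m n).measurePreserving_pi n) hT
    rw [e]
    refine (h.integral_sq_mean_score_sub_le hn).trans ?_
    have h4 := le_max_right 1 (4 * B ^ 2 + 8 * S ^ 2)
    have : 4 * B ^ 2 + 8 * S ^ 2 ≤ K := by
      rw [hK]
      have := sq_nonneg ((C * S + C * B) / √v)
      linarith
    gcongr

end

/-! ### The location family -/

section LocationFamily

/-- The distribution function of `|Y|` evaluated at `|y|`, for `Y` with law `F_θ`. -/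
noncomputable def absProb (d : PositiveC1Density) (θ y : ℝ) : ℝ :=
  (locationLaw d θ).real (Icc (-|y|) |y|)

variable (d : PositiveC1Density) (θ : ℝ)

theorem PositiveC1Density.continuous : Continuous d.f := d.contDiff.continuous

theorem measurable_density : Measurable fun x => ENNReal.ofReal (d.f (x - θ)) := by
  have := d.continuous.measurable
  fun_prop

theorem locationLaw_absolutelyContinuous : locationLaw d θ ≪ volume :=
  withDensity_absolutelyContinuous _ _

theorem absolutelyContinuous_locationLaw : volume ≪ locationLaw d θ :=
  withDensity_absolutelyContinuous' (measurable_density d θ).aemeasurable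
    (ae_of_all _ fun x => by simpa using d.pos _)

instance instNullSingletonClassLocationLaw : NullSingletonClass (locationLaw d θ) :=
  ⟨fun x => locationLaw_absolutelyContinuous d θ (measure_singleton x)⟩

theorem ae_locationLaw_ne_zero : ∀ᵐ y ∂locationLaw d θ, y ≠ 0 := by
  rw [ae_iff]
  simp

theorem absProb_lt_absProb {y y' : ℝ} (h : |y'| < |y|) : absProb d θ y' < absProb d θ y := by
  have hsub : Icc (-|y'|) |y'| ∪ Ioo |y'| |y| ⊆ Icc (-|y|) |y| := by
    rintro x (hx | hx)
    · exact ⟨by linarith [hx.1], by linarith [hx.2]⟩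
    · exact ⟨by linarith [hx.1, abs_nonneg y'], hx.2.le⟩
  have hdisj : Disjoint (Icc (-|y'|) |y'|) (Ioo |y'| |y|) :=
    Set.disjoint_left.2 fun x hx hx' => absurd hx.2 (not_le.2 hx'.1)
  have hpos : 0 < (locationLaw d θ).real (Ioo |y'| |y|) := by
    rw [measureReal_def, ENNReal.toReal_pos_iff]
    refine ⟨pos_iff_ne_zero.2 fun h0 => ?_, measure_lt_top _ _⟩
    have := absolutelyContinuous_locationLaw d θ h0
    rw [Real.volume_Ioo, ENNReal.ofReal_eq_zero] at this
    linarith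
  have h1 := measureReal_mono (μ := locationLaw d θ) hsub
  rw [measureReal_union hdisj measurableSet_Ioo] at h1
  unfold absProb
  linarith

theorem absProb_le_absProb_iff {y y' : ℝ} : absProb d θ y' ≤ absProb d θ y ↔ |y'| ≤ |y| := by
  constructor
  · intro h
    by_contra hlt
    exact absurd h (not_le.2 (absProb_lt_absProb d θ (not_le.1 hlt)))
  · intro h
    exact measureReal_mono (Icc_subset_Icc (neg_le_neg h) h)

theorem absProb_neg (y : ℝ) : absProb d θ (-y) = absProb d θ y := by
  simp [absProb]

theorem absProb_mem (y : ℝ) : absProb d θ y ∈ Icc (0 : ℝ) 1 :=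
  ⟨measureReal_nonneg, measureReal_le_one⟩

theorem continuous_absProb : Continuous (absProb d θ) := by
  have hc : Continuous fun b : ℝ => ∫ _ in (0 : ℝ)..b, (1 : ℝ) ∂locationLaw d θ :=
    intervalIntegral.continuous_primitive (fun a b => intervalIntegrable_const) 0
  have e : absProb d θ = fun y => (∫ _ in (0 : ℝ)..|y|, (1 : ℝ) ∂locationLaw d θ)
      - ∫ _ in (0 : ℝ)..(-|y|), (1 : ℝ) ∂locationLaw d θ := by
    ext y
    rw [intervalIntegral.integral_interval_sub_left intervalIntegrable_const
      intervalIntegrable_const, intervalIntegral.integral_const', Ioc_eq_empty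
      (show ¬ |y| < -|y| by linarith [abs_nonneg y]), absProb, measureReal_congr Ioc_ae_eq_Icc.symm]
    simp
  rw [e]
  exact (hc.comp continuous_abs).sub (hc.comp continuous_abs.neg)

theorem exists_lt_locationLaw_Icc {u : ℝ} (hu : u < 1) :
    ∃ n : ℕ, u < (locationLaw d θ).real (Icc (-(n : ℝ)) n) := by
  have hmono : Monotone fun n : ℕ => Icc (-(n : ℝ)) n := fun a b hab => by
    have : (a : ℝ) ≤ b := by exact_mod_cast hab
    exact Icc_subset_Icc (neg_le_neg this) this
  have hU : ⋃ n : ℕ, Icc (-(n : ℝ)) n = univ := by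
    refine eq_univ_of_forall fun x => mem_iUnion.2 ?_
    obtain ⟨n, hn⟩ := exists_nat_ge |x|
    exact ⟨n, abs_le.1 hn⟩
  have := tendsto_measure_iUnion_atTop (μ := locationLaw d θ) hmono
  rw [hU, measure_univ] at this
  have h2 := (ENNReal.tendsto_toReal ENNReal.one_ne_top).comp this
  rw [ENNReal.toReal_one] at h2
  exact (h2.eventually_const_lt hu).exists

/-- The probability integral transform for `|Y|`. -/
theorem map_absProb : (locationLaw d θ).map (absProb d θ) = unifLaw := by
  have hm := (continuous_absProb d θ).measurable
  have : IsProbabilityMeasure ((locationLaw d θ).map (absProb d θ)) :=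
    Measure.isProbabilityMeasure_map hm.aemeasurable
  refine Measure.ext_of_Iic _ _ fun a => ?_
  rw [← measureReal_eq_measureReal_iff, map_measureReal_apply hm measurableSet_Iic]
  rcases lt_or_ge a 0 with ha | ha
  · have h1 : absProb d θ ⁻¹' Iic a = ∅ := by
      ext y
      simpa using ha.trans_le (absProb_mem d θ y).1
    have h2 : Iic a ∩ Icc (0 : ℝ) 1 = ∅ := by
      ext y
      simp only [mem_inter_iff, mem_Iic, mem_Icc, mem_empty_iff_false, iff_false]
      intro h
      linarith [h.1, h.2.1]
    rw [h1, unifLaw, measureReal_restrict_apply measurableSet_Iic, h2]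
    simp
  rcases lt_or_ge a 1 with ha' | ha'
  · rw [unifLaw_real_Iic ⟨ha, ha'.le⟩]
    obtain ⟨n, hn⟩ := exists_lt_locationLaw_Icc d θ ha'
    have h0 : absProb d θ 0 = 0 := by simp [absProb, measureReal_def]
    have hn' : absProb d θ n = (locationLaw d θ).real (Icc (-(n : ℝ)) n) := by simp [absProb]
    obtain ⟨t, -, ht⟩ := intermediate_value_Icc (Nat.cast_nonneg (α := ℝ) n)
      (continuous_absProb d θ).continuousOn
      (show a ∈ Icc (absProb d θ 0) (absProb d θ n) from
        ⟨by rw [h0]; exact ha, by rw [hn']; exact hn.le⟩)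
    have h1 : absProb d θ ⁻¹' Iic a = Icc (-|t|) |t| := by
      ext y
      rw [mem_preimage, mem_Iic, ← ht, absProb_le_absProb_iff, mem_Icc, abs_le]
    rw [h1]
    exact ht
  · have h1 : absProb d θ ⁻¹' Iic a = univ :=
      eq_univ_of_forall fun y => (absProb_mem d θ y).2.trans ha'
    have h2 : Iic a ∩ Icc (0 : ℝ) 1 = Icc 0 1 :=
      inter_eq_right.2 fun y hy => hy.2.trans ha'
    rw [h1, unifLaw, measureReal_restrict_apply measurableSet_Iic, h2]
    simp

theorem measurable_sgnInd : Measurable sgnInd :=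
  Measurable.ite measurableSet_Ici measurable_const measurable_const

theorem abs_sgnInd_le (y : ℝ) : |sgnInd y| ≤ 1 := by
  unfold sgnInd; split_ifs <;> simp

/-- The asymptotic centre `E[sgn(Y) ψ(G(Y))] / ∫ ψ` of the statistic, for `G = absProb d θ`. -/
noncomputable def rankCentre (d : PositiveC1Density) (ψ : ℝ → ℝ) (θ : ℝ) : ℝ :=
  (∫ y, sgnInd y * ψ (absProb d θ y) ∂locationLaw d θ) / ∫ x, ψ x ∂unifLaw

/-- The sign recentred at the asymptotic centre of the statistic. -/
noncomputable def signWeight (d : PositiveC1Density) (ψ : ℝ → ℝ) (θ y : ℝ) : ℝ :=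
  sgnInd y - rankCentre d ψ θ

/-- The asymptotic variance of the numerator `∑ w(Y_i) ψ(R_i) / √n`: the second moment of its
influence function. -/
noncomputable def rankVariance (d : PositiveC1Density) (ψ ψd : ℝ → ℝ) (θ : ℝ) : ℝ :=
  ∫ z, influence (locationLaw d θ) (absProb d θ) (signWeight d ψ θ) ψ ψd z ^ 2 ∂locationLaw d θ

variable {ψ ψd : ℝ → ℝ} {B S : ℝ}

theorem abs_rankCentre_le (h : SmoothScore ψ ψd B S) (hc : 0 < ∫ x, ψ x ∂unifLaw) :
    |rankCentre d ψ θ| ≤ S / ∫ x, ψ x ∂unifLaw := by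
  rw [rankCentre, abs_div, abs_of_pos hc]
  refine div_le_div_of_nonneg_right ?_ hc.le
  have := norm_integral_le_of_norm_le_const (μ := locationLaw d θ)
    (f := fun y => sgnInd y * ψ (absProb d θ y)) (C := S) (ae_of_all _ fun y => by
      rw [Real.norm_eq_abs, abs_mul]
      have := mul_le_mul (abs_sgnInd_le y) (h.bdd (absProb d θ y)) (abs_nonneg _) zero_le_one
      simpa using this)
  simpa using this

theorem rankModel_locationLaw (h : SmoothScore ψ ψd B S) (hc : 0 < ∫ x, ψ x ∂unifLaw) :
    RankModel (locationLaw d θ) (absProb d θ) (signWeight d ψ θ) (1 + S / ∫ x, ψ x ∂unifLaw) where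
  measurable := (continuous_absProb d θ).measurable
  mem := absProb_mem d θ
  map_eq := map_absProb d θ
  measurable_weight := measurable_sgnInd.sub_const _
  weight_bdd y := (abs_sub _ _).trans (add_le_add (abs_sgnInd_le y) (abs_rankCentre_le d θ h hc))

theorem integral_comp_absProb {g : ℝ → ℝ} (hg : Measurable g) :
    ∫ y, g (absProb d θ y) ∂locationLaw d θ = ∫ x, g x ∂unifLaw :=
  integral_comp_of_measurePreserving
    ⟨(continuous_absProb d θ).measurable, map_absProb d θ⟩ hg

theorem integral_signWeight_mul_score (h : SmoothScore ψ ψd B S) (hc : 0 < ∫ x, ψ x ∂unifLaw) :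
    ∫ y, signWeight d ψ θ y * ψ (absProb d θ y) ∂locationLaw d θ = 0 := by
  have hm := h.continuous.measurable.comp (continuous_absProb d θ).measurable
  have i1 : Integrable (fun y => sgnInd y * ψ (absProb d θ y)) (locationLaw d θ) := by
    refine integrable_of_abs_le (M := 1 * S) (measurable_sgnInd.mul hm).aemeasurable fun y => ?_
    rw [abs_mul]
    exact mul_le_mul (abs_sgnInd_le y) (h.bdd (absProb d θ y)) (abs_nonneg _) zero_le_one
  have i2 : Integrable (fun y => ψ (absProb d θ y)) (locationLaw d θ) :=
    integrable_of_abs_le hm.aemeasurable fun y => h.bdd _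
  unfold signWeight
  simp only [sub_mul]
  rw [integral_sub i1 (i2.const_mul _), integral_const_mul,
    integral_comp_absProb d θ h.continuous.measurable, rankCentre, div_mul_cancel₀ _ hc.ne',
    sub_self]

/-- All rank terms are even in `y`, so only the sign distinguishes `y` from `-y`. -/
theorem influence_sub_influence_neg_sq {y : ℝ} (hy : y ≠ 0) :
    (influence (locationLaw d θ) (absProb d θ) (signWeight d ψ θ) ψ ψd y
      - influence (locationLaw d θ) (absProb d θ) (signWeight d ψ θ) ψ ψd (-y)) ^ 2
      = ψ (absProb d θ y) ^ 2 := by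
  have e : influence (locationLaw d θ) (absProb d θ) (signWeight d ψ θ) ψ ψd y
      - influence (locationLaw d θ) (absProb d θ) (signWeight d ψ θ) ψ ψd (-y)
      = (sgnInd y - sgnInd (-y)) * ψ (absProb d θ y) := by
    simp only [influence, rankCorrection, rankKernel, absProb_neg, signWeight]
    ring
  rw [e, mul_pow]
  have : (sgnInd y - sgnInd (-y)) ^ 2 = 1 := by
    unfold sgnInd
    rcases lt_or_gt_of_ne hy with h | h
    · rw [if_neg (by linarith), if_pos (by linarith)]; norm_num
    · rw [if_pos h.le, if_neg (by linarith)]; norm_num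
  rw [this, one_mul]

theorem integral_locationLaw (F : ℝ → ℝ) :
    ∫ y, F y ∂locationLaw d θ = ∫ y, d.f (y - θ) * F y := by
  rw [locationLaw, integral_withDensity_eq_integral_toReal_smul (measurable_density d θ)
    (ae_of_all _ fun x => ENNReal.ofReal_lt_top)]
  simp only [ENNReal.toReal_ofReal (d.pos _).le, smul_eq_mul]

theorem integrable_density_mul {F : ℝ → ℝ} (hF : Integrable F (locationLaw d θ)) :
    Integrable fun y => d.f (y - θ) * F y := by
  rw [locationLaw, integrable_withDensity_iff_integrable_smul' (measurable_density d θ)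
    (ae_of_all _ fun x => ENNReal.ofReal_lt_top)] at hF
  simpa only [ENNReal.toReal_ofReal (d.pos _).le, smul_eq_mul] using hF

theorem locationLaw_Icc (a b : ℝ) :
    locationLaw d θ (Icc a b) = locationLaw d 0 (Icc (a - θ) (b - θ)) := by
  rw [locationLaw, locationLaw, withDensity_apply _ measurableSet_Icc,
    withDensity_apply _ measurableSet_Icc, ← lintegral_indicator measurableSet_Icc,
    ← lintegral_indicator measurableSet_Icc,
    ← lintegral_sub_right_eq_self (fun x => (Icc (a - θ) (b - θ)).indicator
      (fun x => ENNReal.ofReal (d.f (x - 0))) x) θ]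
  congr 1
  ext x
  simp [indicator]

/-- Reflecting a nonnegative function at the origin increases its integral over a symmetric interval
by at most the factor by which the density at `-z` exceeds the density at `z`. -/
theorem integral_reflect_le {K r M : ℝ}
    (hf : ∀ z ∈ Icc (-K) K, d.f (-z - θ) ≤ r * d.f (z - θ)) {g : ℝ → ℝ} (hg : Measurable g)
    (hg0 : ∀ z, 0 ≤ g z) (hM : ∀ z, g z ≤ M) :
    ∫ z, (Icc (-K) K).indicator (fun z => g (-z)) z ∂locationLaw d θ
      ≤ r * ∫ z, (Icc (-K) K).indicator g z ∂locationLaw d θ := by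
  have hi : Integrable ((Icc (-K) K).indicator g) (locationLaw d θ) :=
    (integrable_of_abs_le hg.aemeasurable fun z => by
      rw [abs_of_nonneg (hg0 z)]; exact hM z).indicator measurableSet_Icc
  rw [integral_locationLaw, integral_locationLaw, ← integral_neg_eq_self, ← integral_const_mul]
  refine integral_mono_of_nonneg (ae_of_all _ fun z => ?_)
    ((integrable_density_mul d θ hi).const_mul r) (ae_of_all _ fun z => ?_)
  · exact mul_nonneg (d.pos _).le (indicator_nonneg (fun _ _ => hg0 _) _)
  · have hmem : -z ∈ Icc (-K) K ↔ z ∈ Icc (-K) K := by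
      simp only [mem_Icc]; constructor <;> rintro ⟨h1, h2⟩ <;> constructor <;> linarith
    by_cases hz : z ∈ Icc (-K) K
    · simp only [indicator_of_mem hz, indicator_of_mem (hmem.2 hz), neg_neg]
      rw [← mul_assoc]
      exact mul_le_mul_of_nonneg_right (hf z hz) (hg0 z)
    · simp [indicator_of_notMem hz, indicator_of_notMem (fun h => hz (hmem.1 h))]

/-- The asymptotic variance is bounded away from zero on bounded sets of parameters. -/
theorem exists_le_rankVariance (h : SmoothScore ψ ψd B S) (hc : 0 < ∫ x, ψ x ∂unifLaw) (A : ℝ) :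
    ∃ v, 0 < v ∧ ∀ θ, |θ| ≤ A → v ≤ rankVariance d ψ ψd θ := by
  set c := ∫ x, ψ x ∂unifLaw with hcdef
  have hψm := h.continuous.measurable
  set A' := max A 0 with hA'
  have hA0 : 0 ≤ A' := le_max_right _ _
  -- outside `[-K, K]` the laws with `|θ| ≤ A` have mass at most `η`
  set η : ℝ := c ^ 2 / (2 * (S ^ 2 + 1)) with hη
  have hη0 : 0 < η := by positivity
  obtain ⟨N, hN⟩ := exists_lt_locationLaw_Icc d 0 (show 1 - η < 1 by linarith)
  set K : ℝ := N + A' with hK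
  have hK0 : 0 ≤ K := by positivity
  have hcomp : IsCompact (Icc (-(K + A')) (K + A')) := isCompact_Icc
  have hne : (Icc (-(K + A')) (K + A')).Nonempty := ⟨0, by constructor <;> linarith⟩
  obtain ⟨x₁, -, hx₁⟩ := hcomp.exists_isMinOn hne d.continuous.continuousOn
  obtain ⟨x₂, -, hx₂⟩ := hcomp.exists_isMaxOn hne d.continuous.continuousOn
  set r : ℝ := d.f x₂ / d.f x₁ with hr
  have hr0 : 0 < r := div_pos (d.pos _) (d.pos _)
  refine ⟨c ^ 2 / 2 / (2 * (1 + r)), by positivity, fun θ hθ => ?_⟩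
  have hθ' : |θ| ≤ A' := hθ.trans (le_max_left _ _)
  obtain ⟨hθ1, hθ2⟩ := abs_le.1 hθ'
  set L := influence (locationLaw d θ) (absProb d θ) (signWeight d ψ θ) ψ ψd with hL
  have m := rankModel_locationLaw d θ h hc
  have hLm : Measurable L := m.measurable_influence h
  set M := (1 + S / c) * S + (1 + S / c) * B with hM
  have hLb : ∀ z, L z ^ 2 ≤ M ^ 2 := fun z => by
    rw [← sq_abs]
    exact pow_le_pow_left₀ (abs_nonneg _) (m.abs_influence_le h z) 2
  have hL2i : Integrable (fun z => L z ^ 2) (locationLaw d θ) :=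
    integrable_of_abs_le (hLm.pow_const 2).aemeasurable fun z => by
      rw [abs_of_nonneg (sq_nonneg _)]; exact hLb z
  have hL2i' : Integrable (fun z => L (-z) ^ 2) (locationLaw d θ) :=
    integrable_of_abs_le ((hLm.comp measurable_neg).pow_const 2).aemeasurable fun z => by
      rw [abs_of_nonneg (sq_nonneg _)]; exact hLb (-z)
  have hrefl : ∫ z, (Icc (-K) K).indicator (fun z => L (-z) ^ 2) z ∂locationLaw d θ
      ≤ r * ∫ z, (Icc (-K) K).indicator (fun z => L z ^ 2) z ∂locationLaw d θ := by
    refine integral_reflect_le d θ (fun z hz => ?_) (hLm.pow_const 2)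
      (fun z => sq_nonneg _) hLb
    have h1 : -z - θ ∈ Icc (-(K + A')) (K + A') := ⟨by linarith [hz.2], by linarith [hz.1]⟩
    have h2 : z - θ ∈ Icc (-(K + A')) (K + A') := ⟨by linarith [hz.1], by linarith [hz.2]⟩
    have h3 : d.f (-z - θ) ≤ d.f x₂ := hx₂ h1
    have h4 : d.f x₁ ≤ d.f (z - θ) := hx₁ h2
    rw [hr, div_mul_eq_mul_div, le_div_iff₀ (d.pos _)]
    exact mul_le_mul h3 h4 (d.pos _).le (d.pos _).le
  have hle : ∫ z, (Icc (-K) K).indicator (fun z => L z ^ 2) z ∂locationLaw d θ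
      ≤ rankVariance d ψ ψd θ :=
    integral_mono (hL2i.indicator measurableSet_Icc) hL2i
      (indicator_le_self' fun _ _ => sq_nonneg _)
  have hψ2i : Integrable (fun z => ψ (absProb d θ z) ^ 2) (locationLaw d θ) :=
    integrable_of_abs_le (M := S ^ 2)
      ((hψm.comp (continuous_absProb d θ).measurable).pow_const 2).aemeasurable fun z => by
      rw [abs_pow]
      exact pow_le_pow_left₀ (abs_nonneg _) (h.bdd _) 2
  have hup : ∫ z, (Icc (-K) K).indicator (fun z => ψ (absProb d θ z) ^ 2) z ∂locationLaw d θ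
      ≤ 2 * (1 + r) * rankVariance d ψ ψd θ := by
    have j1 := (hL2i.indicator (measurableSet_Icc (a := -K) (b := K))).const_mul 2
    have j2 := (hL2i'.indicator (measurableSet_Icc (a := -K) (b := K))).const_mul 2
    have hae : (Icc (-K) K).indicator (fun z => ψ (absProb d θ z) ^ 2) ≤ᵐ[locationLaw d θ]
        fun z => 2 * (Icc (-K) K).indicator (fun z => L z ^ 2) z
          + 2 * (Icc (-K) K).indicator (fun z => L (-z) ^ 2) z := by
      filter_upwards [ae_locationLaw_ne_zero d θ] with z hz
      by_cases hzK : z ∈ Icc (-K) K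
      · simp only [indicator_of_mem hzK]
        rw [← influence_sub_influence_neg_sq d θ (ψ := ψ) (ψd := ψd) hz]
        have := sq_nonneg (L z + L (-z))
        nlinarith
      · simp [indicator_of_notMem hzK]
    refine (integral_mono_ae (hψ2i.indicator measurableSet_Icc) (j1.add j2) hae).trans ?_
    refine (integral_add j1 j2).trans_le ?_
    rw [integral_const_mul, integral_const_mul]
    nlinarith
  have hlow : c ^ 2 / 2
      ≤ ∫ z, (Icc (-K) K).indicator (fun z => ψ (absProb d θ z) ^ 2) z ∂locationLaw d θ := by
    have hsq : c ^ 2 ≤ ∫ z, ψ (absProb d θ z) ^ 2 ∂locationLaw d θ := by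
      rw [integral_comp_absProb d θ (g := fun x => ψ x ^ 2) (hψm.pow_const 2)]
      have k1 : Integrable ψ unifLaw := integrable_of_abs_le hψm.aemeasurable h.bdd
      have k2 : Integrable (fun x => ψ x ^ 2) unifLaw :=
        integrable_of_abs_le (M := S ^ 2) (hψm.pow_const 2).aemeasurable fun x => by
          rw [abs_pow]
          exact pow_le_pow_left₀ (abs_nonneg _) (h.bdd _) 2
      have k3 : ∫ x, (2 * c * ψ x - c ^ 2) ∂unifLaw ≤ ∫ x, ψ x ^ 2 ∂unifLaw :=
        integral_mono ((k1.const_mul _).sub (integrable_const _)) k2 fun x => by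
          have := sq_nonneg (ψ x - c)
          simp only
          nlinarith
      rw [integral_sub (k1.const_mul _) (integrable_const _), integral_const_mul, ← hcdef] at k3
      simp only [integral_const, probReal_univ, one_smul] at k3
      nlinarith
    have htail : (locationLaw d θ).real (Icc (-K) K)ᶜ ≤ η := by
      rw [probReal_compl_eq_one_sub measurableSet_Icc, measureReal_def, locationLaw_Icc,
        ← measureReal_def]
      have hsub : Icc (-(N : ℝ)) N ⊆ Icc (-K - θ) (K - θ) :=
        Icc_subset_Icc (by linarith) (by linarith)
      have := measureReal_mono (μ := locationLaw d 0) hsub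
      linarith
    have hsplit : ∫ z, ψ (absProb d θ z) ^ 2 ∂locationLaw d θ
        ≤ (∫ z, (Icc (-K) K).indicator (fun z => ψ (absProb d θ z) ^ 2) z ∂locationLaw d θ)
          + S ^ 2 * (locationLaw d θ).real (Icc (-K) K)ᶜ := by
      have j2 : Integrable ((Icc (-K) K)ᶜ.indicator fun _ : ℝ => S ^ 2) (locationLaw d θ) :=
        (integrable_const _).indicator measurableSet_Icc.compl
      have e : ∫ z, (Icc (-K) K)ᶜ.indicator (fun _ : ℝ => S ^ 2) z ∂locationLaw d θ
          = S ^ 2 * (locationLaw d θ).real (Icc (-K) K)ᶜ := by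
        rw [integral_indicator_const _ measurableSet_Icc.compl, smul_eq_mul, mul_comm]
      rw [← e, ← integral_add (hψ2i.indicator measurableSet_Icc) j2]
      refine integral_mono hψ2i ((hψ2i.indicator measurableSet_Icc).add j2) fun z => ?_
      by_cases hz : z ∈ Icc (-K) K
      · have hz' : z ∉ (Icc (-K) K)ᶜ := fun h => h hz
        simp [indicator_of_mem hz, indicator_of_notMem hz']
      · have hz' : z ∈ (Icc (-K) K)ᶜ := hz
        simp only [indicator_of_notMem hz, indicator_of_mem hz', zero_add]
        rw [← sq_abs]
        exact pow_le_pow_left₀ (abs_nonneg _) (h.bdd _) 2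
    have hSη : S ^ 2 * η ≤ c ^ 2 / 2 := by
      rw [hη, mul_div_assoc', div_le_div_iff₀ (by positivity) (by positivity)]
      nlinarith [sq_nonneg c]
    have := mul_le_mul_of_nonneg_left htail (sq_nonneg S)
    linarith
  rw [div_le_iff₀ (by positivity)]
  linarith

end LocationFamily

/-! ### The signed score statistic -/

theorem coe_absRank {n : ℕ} (y : Fin n → ℝ) (i : Fin n) :
    (absRank y i : ℝ) = ∑ j, if |y j| ≤ |y i| then (1 : ℝ) else 0 := by
  classical
  rw [absRank, Set.ncard_eq_toFinset_card', Set.toFinset_ofPred, Finset.card_filter]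
  push_cast
  rfl

theorem rankScore_eq {ψ ψe : ℝ → ℝ} (heq : ∀ u ∈ Icc (0 : ℝ) 1, ψe u = ψ u)
    (d : PositiveC1Density) (θ : ℝ) {n : ℕ} {y : Fin n → ℝ} {i : Fin n} (hy : y i ≠ 0) :
    rankScore ψ y i = ψe (normRank (fun j => absProb d θ (y j)) i) := by
  rw [heq _ (normRank_mem _ _), rankScore, if_neg hy, coe_absRank, normRank]
  simp only [absProb_le_absProb_iff]

theorem ae_sampleLaw_ne_zero (d : PositiveC1Density) (θ : ℝ) (n : ℕ) :
    ∀ᵐ y ∂sampleLaw d θ n, ∀ i, y i ≠ 0 := by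
  rw [ae_all_iff]
  intro i
  exact (measurePreserving_eval (fun _ : Fin n => locationLaw d θ) i).quasiMeasurePreserving.ae
    (ae_locationLaw_ne_zero d θ)

theorem signedScore_ae_eq {ψ ψe : ℝ → ℝ} (heq : ∀ u ∈ Icc (0 : ℝ) 1, ψe u = ψ u)
    (d : PositiveC1Density) (θ : ℝ) (n : ℕ) :
    (fun y : Fin n → ℝ => signedScore ψ y) =ᵐ[sampleLaw d θ n] fun y =>
      (∑ i, sgnInd (y i) * ψe (normRank (fun j => absProb d θ (y j)) i))
        / ∑ i, ψe (normRank (fun j => absProb d θ (y j)) i) := by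
  filter_upwards [ae_sampleLaw_ne_zero d θ n] with y hy
  simp only [signedScore, fun i => rankScore_eq heq d θ (hy i)]

section
variable {ψ ψe ψd : ℝ → ℝ} {B S : ℝ}

theorem aemeasurable_signedScore (h : SmoothScore ψe ψd B S)
    (heq : ∀ u ∈ Icc (0 : ℝ) 1, ψe u = ψ u) (d : PositiveC1Density) (θ : ℝ) (n : ℕ) :
    AEMeasurable (fun y : Fin n → ℝ => signedScore ψ y) (sampleLaw d θ n) := by
  refine AEMeasurable.congr (Measurable.aemeasurable ?_) (signedScore_ae_eq heq d θ n).symm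
  have hr : ∀ i : Fin n, Measurable fun y : Fin n → ℝ =>
      ψe (normRank (fun j => absProb d θ (y j)) i) := fun i =>
    h.continuous.measurable.comp ((measurable_normRank i).comp (measurable_pi_lambda _ fun j =>
      (continuous_absProb d θ).measurable.comp (measurable_pi_apply j)))
  exact (Finset.measurable_sum _ fun i _ =>
    (measurable_sgnInd.comp (measurable_pi_apply i)).mul (hr i)).div
      (Finset.measurable_sum _ fun i _ => hr i)

/-- The asymptotic scale of the statistic. -/
noncomputable def rankScale (d : PositiveC1Density) (ψ ψd : ℝ → ℝ) (θ : ℝ) : ℝ :=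
  √(rankVariance d ψ ψd θ) / ∫ x, ψ x ∂unifLaw

theorem rankScale_pos (h : SmoothScore ψe ψd B S) (hc : 0 < ∫ x, ψe x ∂unifLaw)
    (d : PositiveC1Density) (θ : ℝ) : 0 < rankScale d ψe ψd θ := by
  obtain ⟨v, hv, hvle⟩ := exists_le_rankVariance d h hc |θ|
  exact div_pos (Real.sqrt_pos.2 (hv.trans_le (hvle θ le_rfl))) hc

/-- Asymptotic normality of the statistic along every bounded sequence of parameters. The score `ψ`
enters only through its values on `[0, 1]`, so an extension `ψe` with good properties on the whole
line may be used instead. -/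
theorem tendstoInDistribution_signedScore (h : SmoothScore ψe ψd B S)
    (hc : 0 < ∫ x, ψe x ∂unifLaw) (heq : ∀ u ∈ Icc (0 : ℝ) 1, ψe u = ψ u)
    (d : PositiveC1Density) {θ : ℕ → ℝ} {A : ℝ} (hA : ∀ n, |θ n| ≤ A) :
    TendstoInDistribution (fun (n : ℕ) (y : Fin n → ℝ) =>
        √(n : ℝ) * (signedScore ψ y - rankCentre d ψe (θ n)) / rankScale d ψe ψd (θ n))
      atTop (id : ℝ → ℝ) (fun n => sampleLaw d (θ n) n) (gaussianReal 0 1) := by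
  obtain ⟨v, hv, hvle⟩ := exists_le_rankVariance d h hc A
  have hYm : ∀ n : ℕ, AEMeasurable (fun y : Fin n → ℝ =>
      √(n : ℝ) * (signedScore ψ y - rankCentre d ψe (θ n)) / rankScale d ψe ψd (θ n))
      (sampleLaw d (θ n) n) := fun n =>
    (((aemeasurable_signedScore h heq d (θ n) n).sub_const _).const_mul _).div_const _
  rw [tendstoInDistribution_stdGaussian_iff hYm]
  refine tendsto_integral_cexp_rankStatistic (fun n => rankModel_locationLaw d (θ n) h hc) h hc
    (fun n => integral_signWeight_mul_score d (θ n) h hc) hv (fun n => hvle (θ n) (hA n)) hYm ?_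
  intro n
  filter_upwards [signedScore_ae_eq heq d (θ n) n] with y hy hD
  rw [hy]
  have e : (∑ i, sgnInd (y i) * ψe (normRank (fun j => absProb d (θ n) (y j)) i))
        / (∑ i, ψe (normRank (fun j => absProb d (θ n) (y j)) i)) - rankCentre d ψe (θ n)
      = (∑ i, signWeight d ψe (θ n) (y i) * ψe (normRank (fun j => absProb d (θ n) (y j)) i))
        / ∑ i, ψe (normRank (fun j => absProb d (θ n) (y j)) i) := by
    rw [eq_div_iff hD, sub_mul, div_mul_cancel₀ _ hD, Finset.mul_sum, ← Finset.sum_sub_distrib]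
    simp only [signWeight, sub_mul]
  rw [e, rankScale, rankVariance, div_div_eq_mul_div, mul_div_assoc]

/-- At rate `√n` the centre and the scale of an asymptotically normal sequence are unique. The
moduli of the characteristic functions determine the scale; the remaining phases
`exp(i t √n β)` tend to `1` for every `t`, which along squares forces `β = 0`. -/
theorem centre_scale_unique {Ω : ℕ → Type*} {m : ∀ n, MeasurableSpace (Ω n)}
    {P : ∀ n, Measure (Ω n)} [∀ n, IsProbabilityMeasure (P n)] {T : ∀ n, Ω n → ℝ}
    {μ μ' σ σ' : ℝ} (hσ : 0 < σ) (hσ' : 0 < σ')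
    (h : TendstoInDistribution (fun (n : ℕ) ω => √(n : ℝ) * (T n ω - μ) / σ) atTop
      (id : ℝ → ℝ) P (gaussianReal 0 1))
    (h' : TendstoInDistribution (fun (n : ℕ) ω => √(n : ℝ) * (T n ω - μ') / σ') atTop
      (id : ℝ → ℝ) P (gaussianReal 0 1)) : μ = μ' ∧ σ = σ' := by
  have k := (tendstoInDistribution_stdGaussian_iff h.forall_aemeasurable).1 h
  have k' := (tendstoInDistribution_stdGaussian_iff h'.forall_aemeasurable).1 h'
  set β : ℝ := (μ - μ') / σ' with hβ
  have hrel : ∀ (n : ℕ) (t : ℝ),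
      ∫ ω, Complex.exp ((t * (√(n : ℝ) * (T n ω - μ') / σ') : ℝ) * Complex.I) ∂P n
      = Complex.exp ((t * (√(n : ℝ) * β) : ℝ) * Complex.I) *
        ∫ ω, Complex.exp ((t * (σ / σ') * (√(n : ℝ) * (T n ω - μ) / σ) : ℝ) * Complex.I) ∂P n := by
    intro n t
    rw [← integral_const_mul]
    congr 1
    ext ω
    rw [← Complex.exp_add, ← add_mul, ← Complex.ofReal_add]
    congr 3
    rw [hβ]
    field_simp
    ring
  have hσeq : σ = σ' := by
    have n1 := (k' 1).norm
    have n2 := (k (1 * (σ / σ'))).norm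
    have n3 := tendsto_nhds_unique n1 (n2.congr fun n => by
      rw [hrel n 1, norm_mul, Complex.norm_exp_ofReal_mul_I]
      exact (one_mul _).symm)
    rw [← Complex.ofReal_neg, ← Complex.ofReal_neg, ← Complex.ofReal_exp, ← Complex.ofReal_exp,
      Complex.norm_real, Complex.norm_real, Real.norm_eq_abs, Real.norm_eq_abs, Real.abs_exp,
      Real.abs_exp, Real.exp_eq_exp] at n3
    have h1 : (σ / σ') ^ 2 = 1 := by linarith
    have h2 : σ / σ' = 1 := (pow_eq_one_iff_of_nonneg (by positivity) two_ne_zero).1 h1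
    rwa [div_eq_one_iff_eq hσ'.ne'] at h2
  refine ⟨?_, hσeq⟩
  have hone : ∀ t : ℝ, Tendsto (fun n : ℕ => Complex.exp ((t * (√(n : ℝ) * β) : ℝ) * Complex.I))
      atTop (𝓝 1) := by
    intro t
    have hne : Complex.exp (-(t ^ 2 / 2 : ℝ)) ≠ 0 := Complex.exp_ne_zero _
    have q := (k' t).div (k t) hne
    rw [div_self hne] at q
    refine q.congr' ?_
    filter_upwards [(k t).eventually_ne hne] with n hn
    simp only [Pi.div_apply]
    rw [hrel n t, hσeq, div_self hσ'.ne', mul_one, ← hσeq, mul_div_assoc, div_self hn, mul_one]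
  have hexp : ∀ t : ℝ, Complex.exp ((t * β : ℝ) * Complex.I) = 1 := by
    intro t
    -- along `n = m ^ 2` the phase is `exp(i t m β)`, and consecutive terms differ by a fixed factor
    have hsq : Tendsto (fun m : ℕ => m ^ 2) atTop atTop := tendsto_pow_atTop two_ne_zero
    have s1 : Tendsto (fun m : ℕ => Complex.exp ((t * (m * β) : ℝ) * Complex.I)) atTop (𝓝 1) := by
      refine ((hone t).comp hsq).congr fun m => ?_
      simp only [Function.comp, Nat.cast_pow, Real.sqrt_sq (Nat.cast_nonneg m)]
    have s2 := s1.comp (tendsto_add_atTop_nat 1)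
    have s3 := s1.mul_const (Complex.exp ((t * β : ℝ) * Complex.I))
    rw [one_mul] at s3
    refine tendsto_nhds_unique s3 (s2.congr fun m => ?_)
    simp only [Function.comp]
    rw [← Complex.exp_add, ← add_mul, ← Complex.ofReal_add]
    congr 3
    push_cast
    ring
  by_contra hne
  have hβ0 : β ≠ 0 := div_ne_zero (sub_ne_zero.2 hne) hσ'.ne'
  have := hexp (Real.pi / β)
  rw [div_mul_cancel₀ _ hβ0, Complex.exp_pi_mul_I] at this
  norm_num at this

/-- The score function extends from `[0, 1]` to the line by its boundary values. -/
theorem exists_smoothScore (hψ : DifferentiableOn ℝ ψ (Icc 0 1))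
    (hψ' : ∃ B : ℝ, ∀ u ∈ Icc (0 : ℝ) 1, |derivWithin ψ (Icc 0 1) u| ≤ B) :
    ∃ (ψe ψd : ℝ → ℝ) (B S : ℝ), SmoothScore ψe ψd B S ∧ ∀ u ∈ Icc (0 : ℝ) 1, ψe u = ψ u := by
  obtain ⟨B, hB⟩ := hψ'
  obtain ⟨S, hS⟩ := isCompact_Icc.exists_bound_of_continuousOn hψ.continuousOn
  have hB0 : 0 ≤ B := (abs_nonneg _).trans (hB 0 (by simp))
  have h01 : (0 : ℝ) ≤ 1 := zero_le_one
  refine ⟨fun u => ψ (projIcc 0 1 h01 u), (Ioo (0 : ℝ) 1).indicator (deriv ψ), B, S,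
    ⟨fun u v => ?_, fun u => hS _ (projIcc 0 1 h01 u).2,
      (measurable_deriv ψ).indicator measurableSet_Ioo, fun u => ?_, fun u hu => ?_⟩, fun u hu => ?_⟩
  · have := (convex_Icc (0 : ℝ) 1).norm_image_sub_le_of_norm_derivWithin_le hψ hB
      (projIcc 0 1 h01 v).2 (projIcc 0 1 h01 u).2
    refine this.trans (mul_le_mul_of_nonneg_left ?_ hB0)
    exact abs_projIcc_sub_projIcc h01
  · by_cases hu : u ∈ Ioo (0 : ℝ) 1
    · rw [indicator_of_mem hu, ← derivWithin_of_mem_nhds (Icc_mem_nhds hu.1 hu.2)]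
      exact hB u (Ioo_subset_Icc_self hu)
    · rw [indicator_of_notMem hu, abs_zero]
      exact hB0
  · rw [indicator_of_mem hu]
    have hd : HasDerivAt ψ (deriv ψ u) u :=
      (hψ.differentiableAt (Icc_mem_nhds hu.1 hu.2)).hasDerivAt
    refine hd.congr_of_eventuallyEq ?_
    filter_upwards [Icc_mem_nhds hu.1 hu.2] with x hx
    rw [projIcc_of_mem h01 hx]
  · simp only [projIcc_of_mem h01 hu]

theorem integral_unifLaw_eq (heq : ∀ u ∈ Icc (0 : ℝ) 1, ψe u = ψ u) :
    ∫ x, ψe x ∂unifLaw = ∫ u in (0 : ℝ)..1, ψ u := by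
  rw [intervalIntegral.integral_of_le zero_le_one, unifLaw, ← integral_Icc_eq_integral_Ioc]
  exact setIntegral_congr_fun measurableSet_Icc heq

end

theorem proposition4 (d : PositiveC1Density) (ψ : ℝ → ℝ)
    (hψ : DifferentiableOn ℝ ψ (Icc 0 1))
    (hψ' : ∃ B : ℝ, ∀ u ∈ Icc (0 : ℝ) 1, |derivWithin ψ (Icc 0 1) u| ≤ B)
    (hψ_pos : 0 < ∫ u in (0 : ℝ)..1, ψ u) :
    (∃ μ σ : ℝ → ℝ, IsAsymptoticCentreScale d ψ μ σ) ∧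
    ∀ μ σ : ℝ → ℝ, IsAsymptoticCentreScale d ψ μ σ →
      ∀ θ₀ h : ℝ, 0 < h →
        TendstoInDistribution
          (fun (I : ℕ) (y : Fin I → ℝ) =>
            √(I : ℝ) * (signedScore ψ y - μ (θ₀ + h / √(I : ℝ))) / σ (θ₀ + h / √(I : ℝ)))
          atTop (id : ℝ → ℝ) (fun I => sampleLaw d (θ₀ + h / √(I : ℝ)) I)
          (gaussianReal 0 1) := by
  obtain ⟨ψe, ψd, B, S, hs, heq⟩ := exists_smoothScore hψ hψ'
  have hc : 0 < ∫ x, ψe x ∂unifLaw := by rwa [integral_unifLaw_eq heq]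
  have hfix : IsAsymptoticCentreScale d ψ (rankCentre d ψe) (rankScale d ψe ψd) := fun θ =>
    ⟨rankScale_pos hs hc d θ,
      tendstoInDistribution_signedScore hs hc heq d (θ := fun _ => θ) fun _ => le_rfl⟩
  refine ⟨⟨_, _, hfix⟩, fun μ σ hμσ θ₀ h hh => ?_⟩
  have huniq : ∀ θ, rankCentre d ψe θ = μ θ ∧ rankScale d ψe ψd θ = σ θ := fun θ =>
    centre_scale_unique (hfix θ).1 (hμσ θ).1 (hfix θ).2 (hμσ θ).2
  have hbd : ∀ I : ℕ, |θ₀ + h / √(I : ℝ)| ≤ |θ₀| + h := fun I => by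
    refine (abs_add_le _ _).trans (add_le_add_right ?_ _)
    rw [abs_of_nonneg (by positivity)]
    rcases Nat.eq_zero_or_pos I with rfl | hI
    · simpa using hh.le
    · exact div_le_self hh.le (Real.one_le_sqrt.2 (by exact_mod_cast hI))
  have := tendstoInDistribution_signedScore hs hc heq d hbd
  simpa only [(huniq _).1, (huniq _).2] using this
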